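/- Let $q_1,q_2,K>0$, let $n_0\ge 0$ be an integer, and put $\alpha=\frac{1}{2(q_1+q_2)}$. Let $\Theta$ be the class of all simulation outputs $\hat\theta(\delta)=\theta+b(\delta)+\varepsilon(\delta)/\delta^{q_2}$, $\delta>0$, where $\theta\in\mathbb R$ is the (arbitrary) quantity to be estimated, $b(\delta)=B\delta^{q_1}+o(\delta^{q_1})$ as $\delta\downarrow0$ for some $B\ne0$, and $\varepsilon(\delta)$ is a square-integrable random variable with $E\varepsilon(\delta)=0$ and $\mathrm{Var}(\varepsilon(\delta))\to\sigma^2$ as $\delta\downarrow 0$ for some $\sigma^2>0$. Write $\hat\theta_1(\cdot),\hat\theta_2(\cdot),\ldots$ for independent runs of $\hat\theta(\cdot)$. For $d>0$ let $\mathrm{MSE}_0(\hat\theta(\cdot),d)=E\big(\frac1n\sum_{j=1}^n\hat\theta_j(\delta)-\theta\big)^2$ with $\delta=d(n+n_0)^{-\alpha}$. For $\tilde d>0$ and weights $w^{(n)}=(w_{1,n},\dots,w_{n,n})\in\mathbb R^n$ let $\mathrm{MSE}_1(\hat\theta(\cdot),\tilde d,w^{(n)})=E\big(\sum_{j=1}^n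 w_{j,n}\hat\theta_j(\delta_j)-\theta\big)^2$ with $\delta_j=\tilde d(j+n_0)^{-\alpha}$. For a triangular array $W=(w^{(n)})_{n\ge1}$ let $$R(\hat\theta(\cdot),d,\tilde d,W)=\limsup_{n\to\infty}\frac{\mathrm{MSE}_1(\hat\theta(\cdot),\tilde d,w^{(n)})}{\mathrm{MSE}_0(\hat\theta(\cdot),d)}\in[0,\infty].$$ Let $\mathcal F_K$ be the set of functions $g:(0,\infty)\to(0,\infty)$ with $g(d)\le Kd$ for all $d>0$, and $\mathcal W$ the set of all triangular arrays of real weights. 1. We have $$\min_{g\in\mathcal F_K,\,W\in\mathcal W}\ \sup_{\hat\theta(\cdot)\in\Theta,\,d>0}R(\hat\theta(\cdot),d,g(d),W)=\frac{q_1}{q_1+q_2}\,\frac1{K^{2q_2}},$$ where the minimum is attained. 2. Let $\phi(\kappa)=\phi_n(\kappa)=\sum_{j=1}^n(j+n_0)^{-\kappa}$. For all sufficiently large $n$ the matrix $$\begin{pmatrix}\phi(1)&\phi\big(\frac{q_1+2q_2}{2(q_1+q_2)}\big)\\ \phi\big(\frac{q_1+2q_2}{2(q_1+q_2)}\big)&\phi\big(\frac{q_2}{q_1+q_2}\big)\end{pmatrix}$$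 is invertible and, with $(\xi_{kl})$ denoting its inverse, the problem $$\min_{a:\ (K^{2(q_1+q_2)}-\xi_{11})a^2-2\xi_{12}a-\xi_{22}\ge0}\ |a|^{2q_2/(q_1+q_2)}\big(\xi_{11}a^2+2\xi_{12}a+\xi_{22}\big)^{q_1/(q_1+q_2)}$$ has an optimal solution. If $W^*=(w^*_{j,n})$ is any triangular array such that, for all sufficiently large $n$ and all $j=1,\dots,n$, $$w^*_{j,n}=\frac{\lambda_1^*}{(j+n_0)^{(q_1+2q_2)/(2(q_1+q_2))}}+\frac{\lambda_2^*}{(j+n_0)^{q_2/(q_1+q_2)}},\qquad \begin{pmatrix}\lambda_1^*\\\lambda_2^*\end{pmatrix}=\begin{pmatrix}\xi_{11}&\xi_{12}\\\xi_{21}&\xi_{22}\end{pmatrix}\begin{pmatrix}a^*\\1\end{pmatrix}$$ for some optimal solution $a^*=a^*_n$ of this problem, then $W^*$ together with $g(d)=Kd$ attains the minimum in part 1, and for this choice the supremum over $\hat\theta(\cdot)\in\Theta$, $d>0$ is a maximum. -/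

import Mathlib

open Filter Topology MeasureTheory ProbabilityTheory
open scoped ENNReal

universe u

/-- The class of simulation outputs with bias order `q₁` and noise order `q₂`: for every `δ > 0` one
run outputs `θ + b δ + ε δ / δ ^ q₂`, where `b δ = B δ ^ q₁ + o(δ ^ q₁)` with `B ≠ 0`, and `ε δ` is a
square integrable, centred random variable whose variance tends to `σ² > 0` as `δ` decreases to
`0`. -/
structure SimulationOutput (q₁ q₂ : ℝ) where
  /-- the probability space carrying a single simulation run -/
  Ω : Type u
  [mΩ : MeasurableSpace Ω]
  P : Measure Ω
  [isProb : IsProbabilityMeasure P]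
  /-- the estimated quantity -/
  θ : ℝ
  /-- the bias -/
  b : ℝ → ℝ
  /-- the noise variable `ε(δ)` -/
  ε : ℝ → Ω → ℝ
  B : ℝ
  σsq : ℝ
  B_ne : B ≠ 0
  σsq_pos : 0 < σsq
  bias : (fun δ : ℝ => b δ - B * δ ^ q₁) =o[𝓝[>] (0 : ℝ)] (fun δ : ℝ => δ ^ q₁)
  noise_memLp : ∀ δ : ℝ, 0 < δ → MemLp (ε δ) 2 P
  noise_mean : ∀ δ : ℝ, 0 < δ → ∫ ω, ε δ ω ∂P = 0
  noise_var : Tendsto (fun δ : ℝ => Var[ε δ; P]) (𝓝[>] (0 : ℝ)) (𝓝 σsq)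

attribute [instance] SimulationOutput.mΩ SimulationOutput.isProb

noncomputable section

namespace SimulationOutput

variable {q₁ q₂ : ℝ}

/-- The output of a single run with tuning parameter `δ`. -/
def output (S : SimulationOutput.{u} q₁ q₂) (δ : ℝ) (ω : S.Ω) : ℝ :=
  S.θ + S.b δ + S.ε δ ω / δ ^ q₂

/-- `E (T - θ)²` for an estimator `T` built from `n` independent simulation runs; these live on the
`n`-fold product space, and the `j`-th coordinate drives the `j`-th run. -/
def mse (S : SimulationOutput.{u} q₁ q₂) {n : ℕ} (T : (Fin n → S.Ω) → ℝ) : ℝ≥0∞ :=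
  ∫⁻ ω, ENNReal.ofReal ((T ω - S.θ) ^ 2) ∂(Measure.pi fun _ : Fin n => S.P)

/-- The sample average of `n` runs, all at the tuning parameter `δ`. -/
def sampleAverage (S : SimulationOutput.{u} q₁ q₂) (δ : ℝ) (n : ℕ) (ω : Fin n → S.Ω) : ℝ :=
  (1 / (n : ℝ)) * ∑ j : Fin n, S.output δ (ω j)

/-- The weighted estimator `∑ⱼ wⱼ θ̂ⱼ(δⱼ)`. -/
def weightedEstimator (S : SimulationOutput.{u} q₁ q₂) {n : ℕ} (w δ : Fin n → ℝ)
    (ω : Fin n → S.Ω) : ℝ :=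
  ∑ j : Fin n, w j * S.output (δ j) (ω j)

end SimulationOutput

/-- The exponent `α = 1 / (2 (q₁ + q₂))`. -/
def rateExponent (q₁ q₂ : ℝ) : ℝ := 1 / (2 * (q₁ + q₂))

/-- Mean square error of the sample average of `n` runs at `δ = d (n + n₀) ^ (-α)`. -/
def mseBaseline {q₁ q₂ : ℝ} (n₀ : ℕ) (S : SimulationOutput.{u} q₁ q₂) (d : ℝ) (n : ℕ) : ℝ≥0∞ :=
  S.mse (S.sampleAverage (d * ((n : ℝ) + n₀) ^ (-rateExponent q₁ q₂)) n)

/-- Mean square error of `∑ⱼ wⱼ θ̂ⱼ(δⱼ)`, `δⱼ = d' (j + n₀) ^ (-α)`. The run number `j` ranges over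
`1, …, n`, so the index `j : Fin n` stands for the run number `j + 1`. -/
def mseWeighted {q₁ q₂ : ℝ} (n₀ : ℕ) (S : SimulationOutput.{u} q₁ q₂) (d' : ℝ) {n : ℕ}
    (w : Fin n → ℝ) : ℝ≥0∞ :=
  S.mse (S.weightedEstimator w
    fun j : Fin n => d' * (((j : ℕ) : ℝ) + 1 + n₀) ^ (-rateExponent q₁ q₂))

/-- The asymptotic risk ratio of the weighted estimators with triangular array of weights `W`,
relative to the sample averages. -/
def riskRatio {q₁ q₂ : ℝ} (n₀ : ℕ) (S : SimulationOutput.{u} q₁ q₂) (d d' : ℝ)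
    (W : (n : ℕ) → Fin n → ℝ) : ℝ≥0∞ :=
  limsup (fun n : ℕ => mseWeighted n₀ S d' (W n) / mseBaseline n₀ S d n) atTop

/-- The worst-case asymptotic risk ratio of the calibration `d' = g d`, `W`, over all simulation
outputs and all `d > 0`. -/
def worstRiskRatio (q₁ q₂ : ℝ) (n₀ : ℕ) (g : ℝ → ℝ) (W : (n : ℕ) → Fin n → ℝ) : ℝ≥0∞ :=
  ⨆ (S : SimulationOutput.{u} q₁ q₂) (d : ℝ) (_ : 0 < d), riskRatio n₀ S d (g d) W

/-- Calibration functions with inflation factor at most `K`. -/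
def calibrations (K : ℝ) : Set (ℝ → ℝ) := {g | ∀ d : ℝ, 0 < d → 0 < g d ∧ g d ≤ K * d}

/-- `φ(κ) = ∑_{j=1}^n 1 / (j + n₀) ^ κ`. -/
def phi (n₀ n : ℕ) (κ : ℝ) : ℝ := ∑ j : Fin n, 1 / (((j : ℕ) : ℝ) + 1 + n₀) ^ κ

/-- The matrix of values of `φ`. -/
def phiMatrix (q₁ q₂ : ℝ) (n₀ n : ℕ) : Matrix (Fin 2) (Fin 2) ℝ :=
  !![phi n₀ n 1, phi n₀ n ((q₁ + 2 * q₂) / (2 * (q₁ + q₂)));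
     phi n₀ n ((q₁ + 2 * q₂) / (2 * (q₁ + q₂))), phi n₀ n (q₂ / (q₁ + q₂))]

/-- The matrix `(ξ_{kl})`. -/
def xi (q₁ q₂ : ℝ) (n₀ n : ℕ) : Matrix (Fin 2) (Fin 2) ℝ := (phiMatrix q₁ q₂ n₀ n)⁻¹

/-- Feasible set of the one-dimensional problem in `a`. -/
def feasible (q₁ q₂ K : ℝ) (n₀ n : ℕ) : Set ℝ :=
  {a | 0 ≤ (K ^ (2 * (q₁ + q₂)) - xi q₁ q₂ n₀ n 0 0) * a ^ 2
        - 2 * xi q₁ q₂ n₀ n 0 1 * a - xi q₁ q₂ n₀ n 1 1}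

/-- Objective function of the one-dimensional problem in `a`. -/
def objective (q₁ q₂ : ℝ) (n₀ n : ℕ) (a : ℝ) : ℝ :=
  |a| ^ (2 * q₂ / (q₁ + q₂)) *
    (xi q₁ q₂ n₀ n 0 0 * a ^ 2 + 2 * xi q₁ q₂ n₀ n 0 1 * a + xi q₁ q₂ n₀ n 1 1)
      ^ (q₁ / (q₁ + q₂))

/-- `a` is an optimal solution of the one-dimensional problem. -/
def IsOptimalSolution (q₁ q₂ K : ℝ) (n₀ n : ℕ) (a : ℝ) : Prop :=
  a ∈ feasible q₁ q₂ K n₀ n ∧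
    ∀ a' ∈ feasible q₁ q₂ K n₀ n, objective q₁ q₂ n₀ n a ≤ objective q₁ q₂ n₀ n a'

/-- The vector `(λ₁, λ₂)` belonging to `a`. -/
def coeffs (q₁ q₂ : ℝ) (n₀ n : ℕ) (a : ℝ) : Fin 2 → ℝ :=
  Matrix.mulVec (xi q₁ q₂ n₀ n) ![a, 1]

/-- The two-decay weights belonging to `a`; the index `j : Fin n` stands for the run number
`j + 1`. -/
def twoDecayWeights (q₁ q₂ : ℝ) (n₀ n : ℕ) (a : ℝ) (j : Fin n) : ℝ :=
  coeffs q₁ q₂ n₀ n a 0 / (((j : ℕ) : ℝ) + 1 + n₀) ^ ((q₁ + 2 * q₂) / (2 * (q₁ + q₂))) +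
    coeffs q₁ q₂ n₀ n a 1 / (((j : ℕ) : ℝ) + 1 + n₀) ^ (q₂ / (q₁ + q₂))

end

/-! Write `p = q₁/(q₁+q₂)`, `h_j = j + n₀`, `N = n + n₀`. Up to lower-order terms the weighted
estimator has bias `θ(∑w - 1) + B d'^q₁ ∑ w_j h_j^(-p/2)` and variance `σ² d'^(-2q₂) ∑ w_j²
h_j^(1-p)`, while `N^p` times the baseline error tends to `B² d^(2q₁) + σ² d^(-2q₂)`.

Lower bound (`le_worstRiskRatio`): a finite worst case forces the error to vanish for `θ = 0` and `θ
= 1`, hence `∑w → 1`. By Cauchy-Schwarz the variance sum is then at least about `1/φ(1-p) ~ p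
N^(-p)`. Since `d' ≤ K d`, outputs dominated by noise have ratio close to at least `p K^(-2q₂)`.

Upper bound (`riskRatio_twoDecay`): two-decay weights have total 1, bias sum `a` and variance sum
`V(a) = 1/φ(1-p) + ρ(a-c)²`. As `φ(1)` diverges, `ρ → 0`, so prescribing `a` on the scale `N^(-p/2)`
is asymptotically free. The constraint `V(a) ≤ K^(2(q₁+q₂)) a²` says that the variance factor
`K^(-2q₂) V` is at most the squared-bias factor `K^(2q₁) a²`; at the optimum both, times `N^p`, tend
to `p K^(-2q₂)`. The ratio therefore has the same limit for every output and every `d`. -/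

/-! ### Bias and variance of linear estimators -/

namespace SimulationOutput

variable {q₁ q₂ : ℝ}

/-- Bias-variance decomposition of a weighted estimator. -/
lemma mse_weightedEstimator (S : SimulationOutput.{u} q₁ q₂) {n : ℕ} (w δ : Fin n → ℝ)
    (hδ : ∀ j, 0 < δ j) :
    S.mse (S.weightedEstimator w δ) =
      ENNReal.ofReal ((S.θ * (∑ j, w j - 1) + ∑ j, w j * S.b (δ j)) ^ 2 +
        ∑ j, w j ^ 2 * (Var[S.ε (δ j); S.P] / (δ j ^ q₂) ^ 2)) := by
  set μ : Measure (Fin n → S.Ω) := Measure.pi fun _ : Fin n => S.P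
  set m : ℝ := S.θ * (∑ j, w j - 1) + ∑ j, w j * S.b (δ j) with hm
  let X : Fin n → S.Ω → ℝ := fun j x => (w j / δ j ^ q₂) * S.ε (δ j) x
  have hX : ∀ j, MemLp (X j) 2 S.P := fun j => (S.noise_memLp _ (hδ j)).const_mul _
  have hX' : ∀ j, MemLp (fun ω : Fin n → S.Ω => X j (ω j)) 2 μ := fun j =>
    (hX j).comp_measurePreserving (measurePreserving_eval _ j)
  let Y : (Fin n → S.Ω) → ℝ := ∑ j, fun ω => X j (ω j)
  have hY : MemLp Y 2 μ := memLp_finsetSum' _ fun j _ => hX' j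
  have hYvar : Var[Y; μ] = ∑ j, w j ^ 2 * (Var[S.ε (δ j); S.P] / (δ j ^ q₂) ^ 2) := by
    rw [variance_sum_pi hX]
    refine Finset.sum_congr rfl fun j _ => ?_
    rw [variance_const_mul, div_pow]
    ring
  have hYmean : ∫ ω, Y ω ∂μ = 0 := by
    have : Y = fun ω => ∑ j, X j (ω j) := by
      ext ω; simp [Y]
    rw [this, integral_finsetSum _ fun j _ => (hX' j).integrable (by norm_num)]
    refine Finset.sum_eq_zero fun j _ => ?_
    rw [integral_comp_eval (μ := fun _ : Fin n => S.P) (hX j).aestronglyMeasurable]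
    simp only [X]
    rw [integral_const_mul, S.noise_mean _ (hδ j), mul_zero]
  have hT : ∀ ω, S.weightedEstimator w δ ω - S.θ = m + Y ω := by
    intro ω
    simp only [weightedEstimator, output, hm, Y, X, Finset.sum_apply, mul_add,
      Finset.sum_add_distrib, ← Finset.sum_mul]
    have : ∑ j, w j * (S.ε (δ j) (ω j) / δ j ^ q₂) =
        ∑ j, w j / δ j ^ q₂ * S.ε (δ j) (ω j) :=
      Finset.sum_congr rfl fun j _ => by ring
    rw [this]
    ring
  have hmY : MemLp (fun ω => m + Y ω) 2 μ := (memLp_const m).add hY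
  unfold mse
  simp only [hT]
  rw [← ofReal_integral_eq_lintegral_ofReal hmY.integrable_sq
    (Filter.Eventually.of_forall fun ω => sq_nonneg _)]
  congr 1
  have h1 := variance_eq_sub hmY
  rw [variance_const_add hY.aestronglyMeasurable, hYvar] at h1
  have h2 : ∫ ω, (m + Y ω) ∂μ = m := by
    rw [integral_add (integrable_const _) (hY.integrable (by norm_num)), hYmean]
    simp [μ]
  rw [h2] at h1
  have h3 : ∫ ω, (m + Y ω) ^ 2 ∂μ = μ[(fun ω => m + Y ω) ^ 2] := rfl
  rw [h3]
  linarith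

lemma sampleAverage_eq_weightedEstimator (S : SimulationOutput.{u} q₁ q₂) (δ : ℝ) (n : ℕ) :
    S.sampleAverage δ n = S.weightedEstimator (fun _ => 1 / (n : ℝ)) fun _ => δ := by
  ext ω
  simp [sampleAverage, weightedEstimator, Finset.mul_sum]

lemma mse_sampleAverage (S : SimulationOutput.{u} q₁ q₂) {δ : ℝ} (hδ : 0 < δ) {n : ℕ}
    (hn : n ≠ 0) :
    S.mse (S.sampleAverage δ n) =
      ENNReal.ofReal (S.b δ ^ 2 + Var[S.ε δ; S.P] / (δ ^ q₂) ^ 2 / n) := by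
  have hn' : (n : ℝ) ≠ 0 := by exact_mod_cast hn
  rw [sampleAverage_eq_weightedEstimator, mse_weightedEstimator _ _ _ fun _ => hδ]
  congr 1
  simp only [Finset.sum_const, Finset.card_univ, Fintype.card_fin, nsmul_eq_mul]
  field_simp
  ring

/-- The bias coefficient as a limit. -/
lemma tendsto_bias_div (S : SimulationOutput.{u} q₁ q₂) :
    Tendsto (fun δ => S.b δ / δ ^ q₁) (𝓝[>] 0) (𝓝 S.B) := by
  have h := S.bias.tendsto_div_nhds_zero
  have h2 := h.add_const S.B
  rw [zero_add] at h2
  refine h2.congr' ?_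
  filter_upwards [self_mem_nhdsWithin] with δ hδ
  have : δ ^ q₁ ≠ 0 := (Real.rpow_pos_of_pos hδ _).ne'
  field_simp
  ring

end SimulationOutput

/-! ### Toeplitz summation -/

/-- A Toeplitz-type lemma for triangular arrays. -/
lemma tendsto_sum_mul_zero_of_toeplitz {c : ℕ → ℕ → ℝ} {x : ℕ → ℝ} {C : ℝ}
    (hc : ∀ j, Tendsto (fun n => c n j) atTop (𝓝 0))
    (hC : ∀ᶠ n in atTop, ∑ j ∈ Finset.range n, |c n j| ≤ C) (hx : Tendsto x atTop (𝓝 0)) :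
    Tendsto (fun n => ∑ j ∈ Finset.range n, c n j * x j) atTop (𝓝 0) := by
  have hC0 : 0 ≤ C := by
    obtain ⟨n, hn⟩ := hC.exists
    exact (Finset.sum_nonneg fun j _ => abs_nonneg _).trans hn
  rw [Metric.tendsto_atTop']
  intro e he
  -- `C + 1` instead of `C` keeps the denominator positive when `C = 0`.
  have he' : 0 < e / (2 * (C + 1)) := by positivity
  obtain ⟨M, hM⟩ := (Metric.tendsto_atTop.1 hx) _ he'
  have hfin : Tendsto (fun n => ∑ j ∈ Finset.range M, |c n j| * |x j|) atTop (𝓝 0) := by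
    have : Tendsto (fun n => ∑ j ∈ Finset.range M, |c n j| * |x j|) atTop
        (𝓝 (∑ j ∈ Finset.range M, |(0 : ℝ)| * |x j|)) :=
      tendsto_finsetSum _ fun j _ => (hc j).abs.mul_const _
    simpa using this
  have hev : ∀ᶠ n in atTop, dist (∑ j ∈ Finset.range n, c n j * x j) 0 < e := by
    filter_upwards [hfin.eventually_lt_const (half_pos he), hC, eventually_ge_atTop M]
      with n h1 h2 h3
    rw [Real.dist_0_eq_abs]
    calc |∑ j ∈ Finset.range n, c n j * x j|
        ≤ ∑ j ∈ Finset.range n, |c n j| * |x j| := by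
          refine (Finset.abs_sum_le_sum_abs _ _).trans (le_of_eq ?_)
          exact Finset.sum_congr rfl fun j _ => abs_mul _ _
      _ = ∑ j ∈ Finset.range M, |c n j| * |x j| +
            ∑ j ∈ Finset.Ico M n, |c n j| * |x j| :=
          (Finset.sum_range_add_sum_Ico _ h3).symm
      _ ≤ ∑ j ∈ Finset.range M, |c n j| * |x j| +
            ∑ j ∈ Finset.range n, |c n j| * (e / (2 * (C + 1))) := by
          refine add_le_add le_rfl ?_
          refine (Finset.sum_le_sum fun j hj => ?_).trans
            (Finset.sum_le_sum_of_subset_of_nonneg (t := Finset.range n) ?_ ?_)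
          · have := hM j (Finset.mem_Ico.1 hj).1
            rw [Real.dist_0_eq_abs] at this
            exact mul_le_mul_of_nonneg_left this.le (abs_nonneg _)
          · intro j hj
            exact Finset.mem_range.2 (Finset.mem_Ico.1 hj).2
          · intro j _ _
            positivity
      _ ≤ ∑ j ∈ Finset.range M, |c n j| * |x j| + C * (e / (2 * (C + 1))) := by
          rw [← Finset.sum_mul]
          gcongr
      _ < e / 2 + e / 2 := by
          refine add_lt_add_of_lt_of_le h1 ?_
          rw [mul_div_assoc', div_le_div_iff₀ (by positivity) (by norm_num)]
          nlinarith
      _ = e := add_halves e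
  obtain ⟨n, hn⟩ := eventually_atTop.1 hev
  exact ⟨n, fun k hk => hn k hk.le⟩

/-! ### Growth of the sums `φ` -/

/-- Bernoulli's inequality for exponents in `[0, 1]`, applied to `1 + 1/m`. Together with the next
bound it compares `φ(1 - s)` with a telescoping sum. -/
lemma rpow_add_one_sub_rpow_le {s m : ℝ} (hs : 0 ≤ s) (hs1 : s ≤ 1) (hm : 0 < m) :
    (m + 1) ^ s - m ^ s ≤ s * (1 / m ^ (1 - s)) := by
  have h1 : (m + 1) ^ s = m ^ s * (1 + 1 / m) ^ s := by
    rw [← Real.mul_rpow hm.le (by positivity)]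
    congr 1
    field_simp
  have h2 := rpow_one_add_le_one_add_mul_self (s := 1 / m)
    (by have : 0 < 1 / m := by positivity
        linarith) hs hs1
  have h3 : m ^ (1 - s) = m / m ^ s := by rw [Real.rpow_sub hm, Real.rpow_one]
  have h4 : 0 < m ^ s := Real.rpow_pos_of_pos hm _
  rw [h1, h3]
  calc m ^ s * (1 + 1 / m) ^ s - m ^ s ≤ m ^ s * (1 + s * (1 / m)) - m ^ s := by gcongr
    _ = s * (1 / (m / m ^ s)) := by field_simp; ring

/-- Bernoulli again, now at `1 - 1/(m+1)`. The case `m = 0` is needed for the first summand when `n₀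
= 0`. -/
lemma le_rpow_add_one_sub_rpow {s m : ℝ} (hs : 0 ≤ s) (hs1 : s ≤ 1) (hm : 0 ≤ m) :
    s * (1 / (m + 1) ^ (1 - s)) ≤ (m + 1) ^ s - m ^ s := by
  have hm1 : 0 < m + 1 := by linarith
  have hle : 1 / (m + 1) ≤ 1 := by rw [div_le_one hm1]; linarith
  have h1 : m ^ s = (m + 1) ^ s * (1 + -(1 / (m + 1))) ^ s := by
    rw [← Real.mul_rpow hm1.le (by linarith)]
    congr 1
    field_simp
    ring
  have h2 := rpow_one_add_le_one_add_mul_self (s := -(1 / (m + 1))) (by linarith) hs hs1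
  have h3 : (m + 1) ^ (1 - s) = (m + 1) / (m + 1) ^ s := by rw [Real.rpow_sub hm1, Real.rpow_one]
  have h4 : 0 < (m + 1) ^ s := Real.rpow_pos_of_pos hm1 _
  rw [h1, h3]
  calc s * (1 / ((m + 1) / (m + 1) ^ s))
      = (m + 1) ^ s - (m + 1) ^ s * (1 + s * -(1 / (m + 1))) := by field_simp; ring
    _ ≤ _ := by gcongr

lemma phi_eq_sum_range (n₀ n : ℕ) (κ : ℝ) :
    phi n₀ n κ = ∑ j ∈ Finset.range n, 1 / ((j : ℝ) + 1 + n₀) ^ κ :=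
  Fin.sum_univ_eq_sum_range (fun j : ℕ => 1 / ((j : ℝ) + 1 + n₀) ^ κ) n

lemma tendsto_natCast_add_atTop (c : ℝ) : Tendsto (fun n : ℕ => (n : ℝ) + c) atTop atTop :=
  tendsto_atTop_add_const_right _ _ tendsto_natCast_atTop_atTop

lemma tendsto_rpow_natCast_add_atTop {s : ℝ} (hs : 0 < s) (c : ℝ) :
    Tendsto (fun n : ℕ => ((n : ℝ) + c) ^ s) atTop atTop :=
  (tendsto_rpow_atTop hs).comp (tendsto_natCast_add_atTop c)

/-- `φ(1 - s) ~ N ^ s / s` with `N = n + n₀`. -/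
lemma tendsto_phi_div_rpow (n₀ : ℕ) {s : ℝ} (hs : 0 < s) (hs1 : s ≤ 1) :
    Tendsto (fun n : ℕ => phi n₀ n (1 - s) / ((n : ℝ) + n₀) ^ s) atTop (𝓝 (1 / s)) := by
  have hup : ∀ n : ℕ, s * phi n₀ n (1 - s) ≤ ((n : ℝ) + n₀) ^ s - (n₀ : ℝ) ^ s := by
    intro n
    rw [phi_eq_sum_range, Finset.mul_sum]
    have := Finset.sum_range_sub (fun j : ℕ => ((j : ℝ) + n₀) ^ s) n
    simp only [Nat.cast_zero, zero_add] at this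
    rw [← this]
    refine Finset.sum_le_sum fun j _ => ?_
    have := le_rpow_add_one_sub_rpow (m := (j : ℝ) + n₀) hs.le hs1 (by positivity)
    push_cast
    rwa [show (j : ℝ) + 1 + n₀ = j + n₀ + 1 by ring]
  have hlo : ∀ n : ℕ, ((n : ℝ) + n₀) ^ s - (1 + n₀ : ℝ) ^ s ≤ s * phi n₀ n (1 - s) := by
    intro n
    rw [phi_eq_sum_range, Finset.mul_sum]
    have := Finset.sum_range_sub (fun j : ℕ => ((j : ℝ) + 1 + n₀) ^ s) n
    simp only [Nat.cast_zero, zero_add] at this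
    have h2 : ((n : ℝ) + n₀) ^ s ≤ ((n : ℝ) + 1 + n₀) ^ s :=
      Real.rpow_le_rpow (by positivity) (by linarith) hs.le
    refine (sub_le_sub_right h2 _).trans ?_
    rw [← this]
    refine Finset.sum_le_sum fun j _ => ?_
    have := rpow_add_one_sub_rpow_le (m := (j : ℝ) + 1 + n₀) hs.le hs1 (by positivity)
    push_cast
    rwa [show (j : ℝ) + 1 + 1 + n₀ = j + 1 + n₀ + 1 by ring]
  have hN := tendsto_rpow_natCast_add_atTop hs n₀
  have hlim : ∀ c : ℝ, Tendsto (fun n : ℕ => (((n : ℝ) + n₀) ^ s - c) / ((n : ℝ) + n₀) ^ s / s)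
      atTop (𝓝 (1 / s)) := by
    intro c
    have h1 : Tendsto (fun n : ℕ => (1 - c / ((n : ℝ) + n₀) ^ s) / s) atTop (𝓝 ((1 - 0) / s)) :=
      (tendsto_const_nhds.sub (hN.const_div_atTop c)).div_const s
    rw [sub_zero] at h1
    refine h1.congr' ?_
    filter_upwards [hN.eventually_gt_atTop 0] with n hn
    field_simp
  refine tendsto_of_tendsto_of_tendsto_of_le_of_le' (hlim ((1 + n₀ : ℝ) ^ s))
    (hlim ((n₀ : ℝ) ^ s)) ?_ ?_
  · filter_upwards [hN.eventually_gt_atTop 0] with n hn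
    rw [div_div, mul_comm, ← div_div, div_le_div_iff_of_pos_right hn, div_le_iff₀ hs,
      mul_comm (phi _ _ _)]
    exact hlo n
  · filter_upwards [hN.eventually_gt_atTop 0] with n hn
    rw [div_div _ _ s, mul_comm _ s, ← div_div _ s, div_le_div_iff_of_pos_right hn, le_div_iff₀ hs,
      mul_comm (phi _ _ _)]
    exact hup n

/-- Telescoping `log (1 + 1/x) ≤ 1/x`. Only divergence is used later, not the logarithmic rate. -/
lemma tendsto_phi_one (n₀ : ℕ) : Tendsto (fun n : ℕ => phi n₀ n 1) atTop atTop := by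
  have hlo : ∀ n : ℕ, Real.log ((n : ℝ) + (1 + n₀)) - Real.log (1 + n₀) ≤ phi n₀ n 1 := by
    intro n
    rw [phi_eq_sum_range]
    have := Finset.sum_range_sub (fun j : ℕ => Real.log ((j : ℝ) + (1 + n₀))) n
    simp only [Nat.cast_zero, zero_add] at this
    rw [← this]
    refine Finset.sum_le_sum fun j _ => ?_
    have hpos : (0 : ℝ) < j + 1 + n₀ := by positivity
    rw [← Real.log_div (by positivity) (by positivity), Real.rpow_one]
    refine (Real.log_le_sub_one_of_pos (by positivity)).trans (le_of_eq ?_)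
    push_cast
    rw [← add_assoc, ← add_assoc]
    field_simp
    ring
  refine tendsto_atTop_mono hlo ?_
  exact tendsto_atTop_add_const_right _ _
    (Real.tendsto_log_atTop.comp (tendsto_natCast_add_atTop (1 + n₀)))

/-! ### The constrained problem in one variable -/

/-- `a` minimizes `(a²) ^ (1 - p) V(a) ^ p` subject to `V(a) ≤ κ a²`, where
`V(a) = v + ρ (a - c)²`. -/
def IsConstrainedMin (κ p v ρ c a : ℝ) : Prop :=
  v + ρ * (a - c) ^ 2 ≤ κ * a ^ 2 ∧
    ∀ a', v + ρ * (a' - c) ^ 2 ≤ κ * a' ^ 2 →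
      (a ^ 2) ^ (1 - p) * (v + ρ * (a - c) ^ 2) ^ p ≤
        (a' ^ 2) ^ (1 - p) * (v + ρ * (a' - c) ^ 2) ^ p

/-- The objective is continuous, and coercive because the second factor is at least `v ^ p > 0`. The
constraint set is closed, and nonempty because `κ > ρ` makes the constraint hold for large
arguments. -/
lemma exists_isConstrainedMin {κ p v ρ c : ℝ} (hp : 0 < p) (hp1 : p < 1) (hv : 0 < v)
    (hρ : 0 < ρ) (hκ : ρ < κ) : ∃ a, IsConstrainedMin κ p v ρ c a := by
  let s : Set ℝ := {a | v + ρ * (a - c) ^ 2 ≤ κ * a ^ 2}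
  let f : ℝ → ℝ := fun a => (a ^ 2) ^ (1 - p) * (v + ρ * (a - c) ^ 2) ^ p
  have hs : IsClosed s := isClosed_le (by fun_prop) (by fun_prop)
  have hf : Continuous f := by
    refine Continuous.mul ?_ ?_
    · exact (continuous_id.pow 2).rpow_const fun _ => Or.inr (by linarith)
    · exact (by fun_prop : Continuous fun a => v + ρ * (a - c) ^ 2).rpow_const
        fun _ => Or.inr hp.le
  have hne : ∃ a₀, a₀ ∈ s := by
    have he : 0 < κ - ρ := sub_pos.2 hκ
    -- For `M ≥ 1` the lower-order terms of `v + ρ (M - c)²` are at most `E * M`, and the `M` below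
    -- satisfies `E ≤ (κ - ρ) * M`.
    set E := 2 * ρ * |c| + v + ρ * c ^ 2 with hE
    have hE0 : 0 ≤ E := by positivity
    refine ⟨1 + E / (κ - ρ), ?_⟩
    set M := 1 + E / (κ - ρ) with hM
    have hM1 : 1 ≤ M := by
      have : 0 ≤ E / (κ - ρ) := by positivity
      linarith
    have h1 : (κ - ρ) * M = (κ - ρ) + E := by rw [hM]; field_simp
    have h2 : E * M ≤ (κ - ρ) * M ^ 2 := by
      rw [pow_two, ← mul_assoc, h1]
      nlinarith
    have h3 : -(ρ * M * |c|) ≤ ρ * M * c := by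
      rw [← mul_neg]
      exact mul_le_mul_of_nonneg_left (neg_abs_le c) (by positivity)
    have h4 : v + ρ * c ^ 2 ≤ (v + ρ * c ^ 2) * M :=
      le_mul_of_one_le_right (by positivity) hM1
    change v + ρ * (M - c) ^ 2 ≤ κ * M ^ 2
    rw [hE] at h2
    nlinarith
  obtain ⟨a₀, ha₀⟩ := hne
  have hgrow : Tendsto f (cocompact ℝ) atTop := by
    have h1 : Tendsto (fun a : ℝ => (a ^ 2) ^ (1 - p) * v ^ p) (cocompact ℝ) atTop := by
      refine Tendsto.atTop_mul_const (Real.rpow_pos_of_pos hv _) ?_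
      refine (tendsto_rpow_atTop (by linarith)).comp ?_
      have := (tendsto_pow_atTop (two_ne_zero)).comp (tendsto_norm_cocompact_atTop (E := ℝ))
      refine this.congr fun a => ?_
      simp
    refine tendsto_atTop_mono (fun a => ?_) h1
    refine mul_le_mul_of_nonneg_left ?_ (by positivity)
    exact Real.rpow_le_rpow hv.le (le_add_of_nonneg_right (by positivity)) hp.le
  obtain ⟨a, ha, hmin⟩ := hf.continuousOn.exists_isMinOn' hs ha₀
    (Filter.Eventually.filter_mono inf_le_left (hgrow.eventually_ge_atTop (f a₀)))
  exact ⟨a, ha, fun a' ha' => hmin ha'⟩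

/-- Constraint and objective are homogeneous of degree 2. Scaling by `M = N^(p/2)` makes `v` and `c`
converge and leaves the curvature `ρ` unchanged. -/
lemma IsConstrainedMin.scale {κ p v ρ c a M : ℝ} (h : IsConstrainedMin κ p v ρ c a)
    (hv : 0 ≤ v) (hρ : 0 ≤ ρ) (hM : 0 < M) :
    IsConstrainedMin κ p (v * M ^ 2) ρ (c * M) (a * M) := by
  have hV : ∀ b, v * M ^ 2 + ρ * (b * M - c * M) ^ 2 = (v + ρ * (b - c) ^ 2) * M ^ 2 := by
    intro b; ring
  have hf : ∀ b, ((b * M) ^ 2) ^ (1 - p) * (v * M ^ 2 + ρ * (b * M - c * M) ^ 2) ^ p =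
      (b ^ 2) ^ (1 - p) * (v + ρ * (b - c) ^ 2) ^ p * M ^ 2 := by
    intro b
    rw [hV, mul_pow, Real.mul_rpow (by positivity) (by positivity),
      Real.mul_rpow (by positivity) (by positivity)]
    have : (M ^ 2) ^ (1 - p) * (M ^ 2) ^ p = M ^ 2 := by
      rw [← Real.rpow_add (by positivity)]; simp
    linear_combination (b ^ 2) ^ (1 - p) * (v + ρ * (b - c) ^ 2) ^ p * this
  refine ⟨?_, fun b hb => ?_⟩
  · rw [hV, mul_pow, ← mul_assoc]
    exact mul_le_mul_of_nonneg_right h.1 (by positivity)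
  · have hbM : b = b / M * M := by field_simp
    rw [hbM] at hb ⊢
    rw [hf, hf]
    rw [hV, mul_pow, ← mul_assoc] at hb
    exact mul_le_mul_of_nonneg_right (h.2 _ (le_of_mul_le_mul_right hb (by positivity)))
      (by positivity)

/-- The constraint gives `t² ≥ v/κ`. Conversely, if `t² ≥ y > z > ℓ/κ`, then `√z` is eventually
feasible and has a smaller objective, since both variance terms are compared with `ℓ` as `ρ → 0`.
The limiting problem is even in `t`, so only the square is controlled. -/
lemma tendsto_sq_of_isConstrainedMin {κ p ℓ c₀ : ℝ} {v ρ c t : ℕ → ℝ} (hκ : 0 < κ) (hp : 0 < p)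
    (hp1 : p < 1) (hℓ : 0 < ℓ) (hv : Tendsto v atTop (𝓝 ℓ)) (hρ0 : ∀ᶠ n in atTop, 0 ≤ ρ n)
    (hρ : Tendsto ρ atTop (𝓝 0)) (hc : Tendsto c atTop (𝓝 c₀))
    (ht : ∀ᶠ n in atTop, IsConstrainedMin κ p (v n) (ρ n) (c n) (t n)) :
    Tendsto (fun n => t n ^ 2) atTop (𝓝 (ℓ / κ)) := by
  rw [tendsto_order]
  constructor
  · intro y hy
    filter_upwards [(hv.div_const κ).eventually_const_lt hy, hρ0, ht] with n h1 h2 h3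
    refine h1.trans_le ?_
    rw [div_le_iff₀ hκ, mul_comm]
    exact (le_add_of_nonneg_right (by positivity)).trans h3.1
  · intro y hy
    have hy0 : 0 < y := (by positivity : 0 < ℓ / κ).trans hy
    obtain ⟨z, hz1, hz2⟩ := exists_between hy
    have hz0 : 0 < z := (by positivity : 0 < ℓ / κ).trans hz1
    have hs : √z ^ 2 = z := Real.sq_sqrt hz0.le
    have hV : Tendsto (fun n => v n + ρ n * (√z - c n) ^ 2) atTop (𝓝 ℓ) := by
      have := hv.add (hρ.mul ((tendsto_const_nhds (x := √z)).sub hc |>.pow 2))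
      simpa using this
    have hfeas : ∀ᶠ n in atTop, v n + ρ n * (√z - c n) ^ 2 ≤ κ * √z ^ 2 := by
      refine (hV.eventually_lt_const ?_).mono fun n h => h.le
      rw [hs]
      rwa [div_lt_iff₀ hκ, mul_comm] at hz1
    have hlt : ∀ᶠ n in atTop, z ^ (1 - p) * (v n + ρ n * (√z - c n) ^ 2) ^ p <
        y ^ (1 - p) * v n ^ p := by
      refine Tendsto.eventually_lt ((hV.rpow_const (Or.inr hp.le)).const_mul _)
        ((hv.rpow_const (Or.inr hp.le)).const_mul _) ?_
      exact mul_lt_mul_of_pos_right (Real.rpow_lt_rpow hz0.le hz2 (by linarith))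
        (Real.rpow_pos_of_pos hℓ _)
    filter_upwards [hfeas, hlt, hρ0, ht, hv.eventually_const_lt hℓ] with n h1 h2 h3 h4 h5
    by_contra! h6
    have h7 := h4.2 _ h1
    rw [hs] at h7
    refine (h7.trans_lt h2).not_ge ?_
    refine mul_le_mul (Real.rpow_le_rpow hy0.le h6 (by linarith))
      (Real.rpow_le_rpow h5.le (le_add_of_nonneg_right (by positivity)) hp.le) (by positivity)
      (by positivity)

/-! ### Asymptotics of centre and curvature -/

/-- The value `a` at which the constrained variance is smallest. -/
noncomputable def varianceCenter (n₀ : ℕ) (p : ℝ) (n : ℕ) : ℝ :=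
  phi n₀ n (1 - p / 2) / phi n₀ n (1 - p)

/-- The curvature of the constrained variance as a function of `a`. -/
noncomputable def varianceCurvature (n₀ : ℕ) (p : ℝ) (n : ℕ) : ℝ :=
  1 / (phi n₀ n 1 - phi n₀ n (1 - p / 2) ^ 2 / phi n₀ n (1 - p))

section Asymptotics

variable (n₀ : ℕ) {p : ℝ}

lemma rpow_half_sq {x : ℝ} (hx : 0 ≤ x) (p : ℝ) : (x ^ (p / 2)) ^ 2 = x ^ p := by
  rw [← Real.rpow_natCast, ← Real.rpow_mul hx]
  congr 1
  push_cast
  ring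

lemma eventually_phi_pos (κ : ℝ) : ∀ᶠ n : ℕ in atTop, 0 < phi n₀ n κ := by
  filter_upwards [eventually_gt_atTop 0] with n hn
  rw [phi_eq_sum_range]
  exact Finset.sum_pos (fun j _ => by positivity) (Finset.nonempty_range_iff.2 hn.ne')

lemma tendsto_rpow_half_atTop (hp : 0 < p) :
    Tendsto (fun n : ℕ => ((n : ℝ) + n₀) ^ (p / 2)) atTop atTop :=
  tendsto_rpow_natCast_add_atTop (by linarith) _

lemma tendsto_inv_phi_mul (hp : 0 < p) (hp1 : p < 1) :
    Tendsto (fun n : ℕ => 1 / phi n₀ n (1 - p) * (((n : ℝ) + n₀) ^ (p / 2)) ^ 2) atTop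
      (𝓝 p) := by
  have h := (tendsto_phi_div_rpow n₀ hp hp1.le).inv₀ (by positivity)
  rw [one_div, inv_inv] at h
  refine h.congr fun n => ?_
  rw [rpow_half_sq (by positivity), inv_div]
  ring

lemma tendsto_phi_half_div (hp : 0 < p) (hp1 : p < 1) :
    Tendsto (fun n : ℕ => phi n₀ n (1 - p / 2) / ((n : ℝ) + n₀) ^ (p / 2)) atTop
      (𝓝 (2 / p)) := by
  have h := tendsto_phi_div_rpow n₀ (s := p / 2) (by linarith) (by linarith)
  rwa [one_div_div] at h

lemma tendsto_varianceCenter_mul (hp : 0 < p) (hp1 : p < 1) :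
    Tendsto (fun n : ℕ => varianceCenter n₀ p n * ((n : ℝ) + n₀) ^ (p / 2)) atTop (𝓝 2) := by
  have h := (tendsto_phi_half_div n₀ hp hp1).mul (tendsto_inv_phi_mul n₀ hp hp1)
  rw [div_mul_cancel₀ _ hp.ne'] at h
  refine h.congr' ?_
  filter_upwards [(tendsto_rpow_half_atTop n₀ hp).eventually_gt_atTop 0] with n hn
  unfold varianceCenter
  field_simp

lemma tendsto_phi_half_sq_div (hp : 0 < p) (hp1 : p < 1) :
    Tendsto (fun n : ℕ => phi n₀ n (1 - p / 2) ^ 2 / phi n₀ n (1 - p)) atTop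
      (𝓝 (2 / p * 2)) := by
  refine ((tendsto_phi_half_div n₀ hp hp1).mul (tendsto_varianceCenter_mul n₀ hp hp1)).congr' ?_
  filter_upwards [(tendsto_rpow_half_atTop n₀ hp).eventually_gt_atTop 0] with n hn
  unfold varianceCenter
  field_simp

/-- The quotient converges because `φ(1-p/2)²` and `φ(1-p)` both have order `N^p`, so `φ(1)`
decides. This Schur complement of `phiMatrix` being positive gives invertibility; its divergence
makes the curvature vanish. -/
lemma tendsto_inv_varianceCurvature (hp : 0 < p) (hp1 : p < 1) :
    Tendsto (fun n : ℕ => phi n₀ n 1 - phi n₀ n (1 - p / 2) ^ 2 / phi n₀ n (1 - p)) atTop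
      atTop := by
  simp only [sub_eq_add_neg]
  exact (tendsto_phi_one n₀).atTop_add (tendsto_phi_half_sq_div n₀ hp hp1).neg

lemma tendsto_varianceCurvature (hp : 0 < p) (hp1 : p < 1) :
    Tendsto (varianceCurvature n₀ p) atTop (𝓝 0) :=
  (tendsto_inv_varianceCurvature n₀ hp hp1).const_div_atTop 1

lemma eventually_varianceCurvature_pos (hp : 0 < p) (hp1 : p < 1) :
    ∀ᶠ n in atTop, 0 < varianceCurvature n₀ p n := by
  filter_upwards [(tendsto_inv_varianceCurvature n₀ hp hp1).eventually_gt_atTop 0] with n hn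
  exact one_div_pos.2 hn

/-- Needed for absolute bounds: in the weights, the divergent `φ(1)` always meets a factor of
curvature. -/
lemma tendsto_varianceCurvature_mul_phi_one (hp : 0 < p) (hp1 : p < 1) :
    Tendsto (fun n => varianceCurvature n₀ p n * phi n₀ n 1) atTop (𝓝 1) := by
  have h := ((tendsto_varianceCurvature n₀ hp hp1).mul
    (tendsto_phi_half_sq_div n₀ hp hp1)).const_add 1
  rw [zero_mul, add_zero] at h
  refine h.congr' ?_
  filter_upwards [(tendsto_inv_varianceCurvature n₀ hp hp1).eventually_gt_atTop 0] with n hn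
  unfold varianceCurvature
  rw [one_div, ← eq_sub_iff_add_eq, eq_comm, ← mul_sub, inv_mul_cancel₀ hn.ne']

end Asymptotics

/-! ### The inverse matrix and the problem in `a` -/

section Xi

variable {q₁ q₂ : ℝ} {n₀ n : ℕ}

/-- Every exponent depends on `p = q₁/(q₁+q₂)` alone. -/
lemma exponents_eq (hq₁ : 0 < q₁) (hq₂ : 0 < q₂) :
    (q₁ + 2 * q₂) / (2 * (q₁ + q₂)) = 1 - q₁ / (q₁ + q₂) / 2 ∧
      q₂ / (q₁ + q₂) = 1 - q₁ / (q₁ + q₂) ∧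
      2 * q₂ / (q₁ + q₂) = 2 * (1 - q₁ / (q₁ + q₂)) := by
  have : q₁ + q₂ ≠ 0 := by positivity
  refine ⟨?_, ?_, ?_⟩ <;> field_simp <;> ring

/-- The sample sizes at which `phiMatrix` is positive definite. -/
def PhiNondegenerate (q₁ q₂ : ℝ) (n₀ n : ℕ) : Prop :=
  0 < phi n₀ n (1 - q₁ / (q₁ + q₂)) ∧
    0 < phi n₀ n 1 - phi n₀ n (1 - q₁ / (q₁ + q₂) / 2) ^ 2 / phi n₀ n (1 - q₁ / (q₁ + q₂))

lemma div_add_mem_Ioo (hq₁ : 0 < q₁) (hq₂ : 0 < q₂) :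
    0 < q₁ / (q₁ + q₂) ∧ q₁ / (q₁ + q₂) < 1 :=
  ⟨by positivity, by rw [div_lt_one (by positivity)]; linarith⟩

lemma eventually_phiNondegenerate (n₀ : ℕ) (hq₁ : 0 < q₁) (hq₂ : 0 < q₂) :
    ∀ᶠ n in atTop, PhiNondegenerate q₁ q₂ n₀ n := by
  obtain ⟨hp, hp1⟩ := div_add_mem_Ioo hq₁ hq₂
  exact (eventually_phi_pos n₀ _).and
    ((tendsto_inv_varianceCurvature n₀ hp hp1).eventually_gt_atTop 0)

lemma det_phiMatrix (hq₁ : 0 < q₁) (hq₂ : 0 < q₂) (h : PhiNondegenerate q₁ q₂ n₀ n) :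
    (phiMatrix q₁ q₂ n₀ n).det = phi n₀ n (1 - q₁ / (q₁ + q₂)) *
      (phi n₀ n 1 - phi n₀ n (1 - q₁ / (q₁ + q₂) / 2) ^ 2 / phi n₀ n (1 - q₁ / (q₁ + q₂))) := by
  obtain ⟨e1, e2, -⟩ := exponents_eq hq₁ hq₂
  have := h.1
  rw [phiMatrix, Matrix.det_fin_two_of, e1, e2, mul_sub, mul_div_cancel₀ _ this.ne']
  ring

lemma xi_apply (hq₁ : 0 < q₁) (hq₂ : 0 < q₂) (h : PhiNondegenerate q₁ q₂ n₀ n) :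
    xi q₁ q₂ n₀ n 0 0 = varianceCurvature n₀ (q₁ / (q₁ + q₂)) n ∧
    xi q₁ q₂ n₀ n 0 1 =
      -(varianceCurvature n₀ (q₁ / (q₁ + q₂)) n * varianceCenter n₀ (q₁ / (q₁ + q₂)) n) ∧
    xi q₁ q₂ n₀ n 1 0 =
      -(varianceCurvature n₀ (q₁ / (q₁ + q₂)) n * varianceCenter n₀ (q₁ / (q₁ + q₂)) n) ∧
    xi q₁ q₂ n₀ n 1 1 = 1 / phi n₀ n (1 - q₁ / (q₁ + q₂)) +
      varianceCurvature n₀ (q₁ / (q₁ + q₂)) n * varianceCenter n₀ (q₁ / (q₁ + q₂)) n ^ 2 := by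
  have hd := det_phiMatrix hq₁ hq₂ h
  obtain ⟨e1, e2, -⟩ := exponents_eq hq₁ hq₂
  obtain ⟨h1, h2⟩ := h
  rw [xi, Matrix.inv_def, hd, phiMatrix, Matrix.adjugate_fin_two_of, Ring.inverse_eq_inv', e1, e2]
  simp only [varianceCurvature, varianceCenter, Matrix.smul_apply, Matrix.of_apply,
    Matrix.cons_val_zero, Matrix.cons_val_one, Matrix.cons_val', smul_eq_mul]
  generalize phi n₀ n (1 - q₁ / (q₁ + q₂)) = F at *
  generalize phi n₀ n (1 - q₁ / (q₁ + q₂) / 2) = G at *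
  generalize phi n₀ n 1 = H at *
  have h3 : F * (H - G ^ 2 / F) = F * H - G ^ 2 := by field_simp
  have h4 : 0 < F * H - G ^ 2 := h3 ▸ mul_pos h1 h2
  have h5 : H - G ^ 2 / F = (F * H - G ^ 2) / F := by field_simp
  rw [h5]
  refine ⟨?_, ?_, ?_, ?_⟩ <;> field_simp
  ring

/-- The variance term of the problem in `a`, as a completed square. -/
lemma xi_quadratic (hq₁ : 0 < q₁) (hq₂ : 0 < q₂) (h : PhiNondegenerate q₁ q₂ n₀ n) (a : ℝ) :
    xi q₁ q₂ n₀ n 0 0 * a ^ 2 + 2 * xi q₁ q₂ n₀ n 0 1 * a + xi q₁ q₂ n₀ n 1 1 =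
      1 / phi n₀ n (1 - q₁ / (q₁ + q₂)) + varianceCurvature n₀ (q₁ / (q₁ + q₂)) n *
        (a - varianceCenter n₀ (q₁ / (q₁ + q₂)) n) ^ 2 := by
  obtain ⟨x1, x2, -, x4⟩ := xi_apply hq₁ hq₂ h
  rw [x1, x2, x4]
  ring

lemma isOptimalSolution_iff (hq₁ : 0 < q₁) (hq₂ : 0 < q₂) (K : ℝ)
    (h : PhiNondegenerate q₁ q₂ n₀ n) (a : ℝ) :
    IsOptimalSolution q₁ q₂ K n₀ n a ↔
      IsConstrainedMin (K ^ (2 * (q₁ + q₂))) (q₁ / (q₁ + q₂)) (1 / phi n₀ n (1 - q₁ / (q₁ + q₂)))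
        (varianceCurvature n₀ (q₁ / (q₁ + q₂)) n) (varianceCenter n₀ (q₁ / (q₁ + q₂)) n) a := by
  have hf : ∀ b, b ∈ feasible q₁ q₂ K n₀ n ↔
      1 / phi n₀ n (1 - q₁ / (q₁ + q₂)) + varianceCurvature n₀ (q₁ / (q₁ + q₂)) n *
        (b - varianceCenter n₀ (q₁ / (q₁ + q₂)) n) ^ 2 ≤ K ^ (2 * (q₁ + q₂)) * b ^ 2 := by
    intro b
    rw [← xi_quadratic hq₁ hq₂ h, feasible, Set.mem_ofPred_eq, ← sub_nonneg (b := _ + _ + _)]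
    refine iff_of_eq (congrArg _ ?_)
    ring
  have ho : ∀ b, objective q₁ q₂ n₀ n b = (b ^ 2) ^ (1 - q₁ / (q₁ + q₂)) *
      (1 / phi n₀ n (1 - q₁ / (q₁ + q₂)) + varianceCurvature n₀ (q₁ / (q₁ + q₂)) n *
        (b - varianceCenter n₀ (q₁ / (q₁ + q₂)) n) ^ 2) ^ (q₁ / (q₁ + q₂)) := by
    intro b
    rw [objective, xi_quadratic hq₁ hq₂ h, (exponents_eq hq₁ hq₂).2.2,
      Real.rpow_mul (abs_nonneg b), Real.rpow_two, sq_abs]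
  simp only [IsOptimalSolution, IsConstrainedMin, hf, ho]

/-- For all large `n` the problem in `a` is well posed. -/
lemma eventually_exists_isOptimalSolution (hq₁ : 0 < q₁) (hq₂ : 0 < q₂) {K : ℝ} (hK : 0 < K)
    (n₀ : ℕ) : ∀ᶠ n in atTop, IsUnit (phiMatrix q₁ q₂ n₀ n).det ∧
      ∃ a, IsOptimalSolution q₁ q₂ K n₀ n a := by
  obtain ⟨hp, hp1⟩ := div_add_mem_Ioo hq₁ hq₂
  filter_upwards [eventually_phiNondegenerate n₀ hq₁ hq₂,
    -- Once the curvature is below `K^(2(q₁+q₂))`, the constraint has a positive leading coefficient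
    -- and is feasible.
    (tendsto_varianceCurvature n₀ hp hp1).eventually_lt_const
      (Real.rpow_pos_of_pos hK (2 * (q₁ + q₂)))] with n h1 h2
  refine ⟨?_, ?_⟩
  · rw [det_phiMatrix hq₁ hq₂ h1]
    exact (mul_pos h1.1 h1.2).ne'.isUnit
  · simp only [isOptimalSolution_iff hq₁ hq₂ K h1]
    exact exists_isConstrainedMin hp hp1 (one_div_pos.2 h1.1) (one_div_pos.2 h1.2) h2

end Xi

/-! ### Rates of bias and noise -/

section Rates

variable {q₁ q₂ : ℝ}

/-- With `α = rateExponent q₁ q₂`, this is `q₁ α = p/2`; for the noise below, `2 q₂ α = 1 - p`. -/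
lemma bias_scale (hq₁ : 0 < q₁) (hq₂ : 0 < q₂) {d x : ℝ} (hd : 0 < d) (hx : 0 < x) :
    (d * x ^ (-rateExponent q₁ q₂)) ^ q₁ = d ^ q₁ / x ^ (q₁ / (q₁ + q₂) / 2) := by
  rw [Real.mul_rpow hd.le (by positivity), ← Real.rpow_mul hx.le, div_eq_mul_inv,
    ← Real.rpow_neg hx.le, rateExponent]
  congr 2
  field_simp

lemma noise_scale (hq₁ : 0 < q₁) (hq₂ : 0 < q₂) {d x : ℝ} (hd : 0 < d) (hx : 0 < x) :
    ((d * x ^ (-rateExponent q₁ q₂)) ^ q₂) ^ 2 =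
      (d ^ q₂) ^ 2 / x ^ (1 - q₁ / (q₁ + q₂)) := by
  rw [Real.mul_rpow hd.le (by positivity), ← Real.rpow_mul hx.le, div_eq_mul_inv,
    ← Real.rpow_neg hx.le, rateExponent, mul_pow]
  congr 1
  rw [← Real.rpow_natCast, ← Real.rpow_mul hx.le]
  congr 1
  push_cast
  field_simp
  ring

lemma tendsto_tuning (hq₁ : 0 < q₁) (hq₂ : 0 < q₂) {d : ℝ} (hd : 0 < d) {x : ℕ → ℝ}
    (hx : Tendsto x atTop atTop) :
    Tendsto (fun n => d * x n ^ (-rateExponent q₁ q₂)) atTop (𝓝[>] 0) := by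
  have hα : 0 < rateExponent q₁ q₂ := by unfold rateExponent; positivity
  refine tendsto_nhdsWithin_iff.2 ⟨?_, ?_⟩
  · have := ((tendsto_rpow_neg_atTop hα).comp hx).const_mul d
    rwa [mul_zero] at this
  · filter_upwards [hx.eventually_gt_atTop 0] with n hn
    exact mul_pos hd (Real.rpow_pos_of_pos hn _)

/-- The limit of the scaled mean square error of the sample average. -/
noncomputable def SimulationOutput.limitMSE (S : SimulationOutput.{u} q₁ q₂) (d : ℝ) : ℝ :=
  S.B ^ 2 * (d ^ q₁) ^ 2 + S.σsq / (d ^ q₂) ^ 2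

lemma SimulationOutput.limitMSE_pos (S : SimulationOutput.{u} q₁ q₂) {d : ℝ} (hd : 0 < d) :
    0 < S.limitMSE d := by
  have := S.σsq_pos
  unfold limitMSE
  positivity

lemma exists_mseBaseline_eq (hq₁ : 0 < q₁) (hq₂ : 0 < q₂) (n₀ : ℕ)
    (S : SimulationOutput.{u} q₁ q₂) {d : ℝ} (hd : 0 < d) :
    ∃ y : ℕ → ℝ, (∀ᶠ n in atTop, mseBaseline n₀ S d n = ENNReal.ofReal (y n)) ∧
      Tendsto (fun n : ℕ => (((n : ℝ) + n₀) ^ (q₁ / (q₁ + q₂) / 2)) ^ 2 * y n) atTop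
        (𝓝 (S.limitMSE d)) := by
  set p := q₁ / (q₁ + q₂)
  let N : ℕ → ℝ := fun n => (n : ℝ) + n₀
  have hN : Tendsto N atTop atTop := tendsto_natCast_add_atTop _
  let δ : ℕ → ℝ := fun n => d * N n ^ (-rateExponent q₁ q₂)
  have hδ : Tendsto δ atTop (𝓝[>] 0) := tendsto_tuning hq₁ hq₂ hd hN
  refine ⟨fun n => S.b (δ n) ^ 2 + Var[S.ε (δ n); S.P] / (δ n ^ q₂) ^ 2 / n, ?_, ?_⟩
  · filter_upwards [hN.eventually_gt_atTop 0, eventually_gt_atTop 0] with n h1 h2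
    exact S.mse_sampleAverage (mul_pos hd (Real.rpow_pos_of_pos h1 _)) h2.ne'
  · have hbias := (S.tendsto_bias_div.comp hδ).pow 2 |>.mul_const ((d ^ q₁) ^ 2)
    have hnoise := (S.noise_var.comp hδ).div_const ((d ^ q₂) ^ 2)
    -- The average divides by `n` whereas the tuning uses `n + n₀`; the mismatch disappears in the
    -- limit.
    have hratio : Tendsto (fun n : ℕ => N n / n) atTop (𝓝 1) := by
      have := (tendsto_const_div_atTop_nhds_zero_nat (n₀ : ℝ)).const_add 1
      rw [add_zero] at this
      refine this.congr' ?_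
      filter_upwards [eventually_gt_atTop 0] with n hn
      have : (n : ℝ) ≠ 0 := by exact_mod_cast hn.ne'
      simp only [N]
      field_simp
    have := hbias.add (hnoise.mul hratio)
    rw [mul_one] at this
    refine this.congr' ?_
    filter_upwards [hN.eventually_gt_atTop 0, eventually_gt_atTop 0] with n h1 h2
    have hn : (n : ℝ) ≠ 0 := by exact_mod_cast h2.ne'
    have hb : δ n ^ q₁ = d ^ q₁ / N n ^ (p / 2) := bias_scale hq₁ hq₂ hd h1
    have hv : (δ n ^ q₂) ^ 2 = (d ^ q₂) ^ 2 / N n ^ (1 - p) := noise_scale hq₁ hq₂ hd h1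
    have hNp : N n ^ (1 - p) = N n / (N n ^ (p / 2)) ^ 2 := by
      rw [rpow_half_sq h1.le, Real.rpow_sub h1, Real.rpow_one]
    have hx : 0 < N n ^ (p / 2) := Real.rpow_pos_of_pos h1 _
    have hd1 : 0 < d ^ q₁ := Real.rpow_pos_of_pos hd _
    have hd2 : 0 < d ^ q₂ := Real.rpow_pos_of_pos hd _
    simp only [Function.comp_apply]
    rw [hb, hv, hNp]
    change _ = (N n ^ (p / 2)) ^ 2 * _
    field_simp

/-- Bias-variance decomposition of the weighted estimator. -/
lemma mseWeighted_eq (hq₁ : 0 < q₁) (hq₂ : 0 < q₂) (n₀ : ℕ) (S : SimulationOutput.{u} q₁ q₂)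
    {d : ℝ} (hd : 0 < d) {n : ℕ} (w : Fin n → ℝ) {b v : ℕ → ℝ}
    (hb : ∀ j : ℕ, b j = S.b (d * ((j : ℝ) + 1 + n₀) ^ (-rateExponent q₁ q₂)) /
      (d * ((j : ℝ) + 1 + n₀) ^ (-rateExponent q₁ q₂)) ^ q₁)
    (hv : ∀ j : ℕ, v j = Var[S.ε (d * ((j : ℝ) + 1 + n₀) ^ (-rateExponent q₁ q₂)); S.P]) :
    mseWeighted n₀ S d w = ENNReal.ofReal ((S.θ * (∑ j, w j - 1) + d ^ q₁ *
        ∑ j : Fin n, w j / (((j : ℕ) : ℝ) + 1 + n₀) ^ (q₁ / (q₁ + q₂) / 2) * b j) ^ 2 +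
      1 / (d ^ q₂) ^ 2 *
        ∑ j : Fin n, w j ^ 2 * (((j : ℕ) : ℝ) + 1 + n₀) ^ (1 - q₁ / (q₁ + q₂)) * v j) := by
  have hx : ∀ j : ℕ, (0 : ℝ) < (j : ℝ) + 1 + n₀ := fun j => by positivity
  have hδ : ∀ j : ℕ, 0 < d * ((j : ℝ) + 1 + n₀) ^ (-rateExponent q₁ q₂) := fun j =>
    mul_pos hd (Real.rpow_pos_of_pos (hx j) _)
  rw [mseWeighted, S.mse_weightedEstimator _ _ fun j => hδ j, Finset.mul_sum, Finset.mul_sum]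
  congr 4
  · refine Finset.sum_congr rfl fun j _ => ?_
    have h1 := bias_scale hq₁ hq₂ hd (hx j)
    have h2 : 0 < d ^ q₁ := Real.rpow_pos_of_pos hd _
    have h3 := Real.rpow_pos_of_pos (hx j) (q₁ / (q₁ + q₂) / 2)
    rw [hb, h1]
    field_simp
  · ext j
    have h1 := noise_scale hq₁ hq₂ hd (hx j)
    have h2 : 0 < d ^ q₂ := Real.rpow_pos_of_pos hd _
    have h3 := Real.rpow_pos_of_pos (hx j) (1 - q₁ / (q₁ + q₂))
    rw [hv, h1]
    field_simp

end Rates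

/-! ### Linear and quadratic sums of two-decay weights -/

/-- A weight sequence that mixes two power decays. -/
noncomputable def decayWeight (n₀ : ℕ) (p l m : ℝ) (j : ℕ) : ℝ :=
  l / ((j : ℝ) + 1 + n₀) ^ (1 - p / 2) + m / ((j : ℝ) + 1 + n₀) ^ (1 - p)

section DecayWeight

variable (n₀ : ℕ) (p l m : ℝ) (n : ℕ)

lemma sum_decayWeight : ∑ j ∈ Finset.range n, decayWeight n₀ p l m j =
    l * phi n₀ n (1 - p / 2) + m * phi n₀ n (1 - p) := by
  simp only [decayWeight, phi_eq_sum_range, Finset.sum_add_distrib, Finset.mul_sum, mul_one_div]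

lemma decayWeight_div (j : ℕ) : decayWeight n₀ p l m j / ((j : ℝ) + 1 + n₀) ^ (p / 2) =
    l * (1 / ((j : ℝ) + 1 + n₀) ^ (1 : ℝ)) + m * (1 / ((j : ℝ) + 1 + n₀) ^ (1 - p / 2)) := by
  have hx : (0 : ℝ) < (j : ℝ) + 1 + n₀ := by positivity
  have h1 : ((j : ℝ) + 1 + n₀) ^ (1 : ℝ) =
      ((j : ℝ) + 1 + n₀) ^ (1 - p / 2) * ((j : ℝ) + 1 + n₀) ^ (p / 2) := by
    rw [← Real.rpow_add hx]; congr 1; ring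
  have h2 : ((j : ℝ) + 1 + n₀) ^ (1 - p / 2) =
      ((j : ℝ) + 1 + n₀) ^ (1 - p) * ((j : ℝ) + 1 + n₀) ^ (p / 2) := by
    rw [← Real.rpow_add hx]; congr 1; ring
  rw [decayWeight, add_div, h1, div_div, mul_one_div, mul_one_div, div_div m, ← h2]

lemma sum_decayWeight_div :
    ∑ j ∈ Finset.range n, decayWeight n₀ p l m j / ((j : ℝ) + 1 + n₀) ^ (p / 2) =
      l * phi n₀ n 1 + m * phi n₀ n (1 - p / 2) := by
  simp only [decayWeight_div, phi_eq_sum_range, Finset.sum_add_distrib, Finset.mul_sum]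

lemma sum_abs_decayWeight_div_le :
    ∑ j ∈ Finset.range n, |decayWeight n₀ p l m j / ((j : ℝ) + 1 + n₀) ^ (p / 2)| ≤
      |l| * phi n₀ n 1 + |m| * phi n₀ n (1 - p / 2) := by
  simp only [decayWeight_div, phi_eq_sum_range, Finset.mul_sum]
  rw [← Finset.sum_add_distrib]
  refine Finset.sum_le_sum fun j _ => (abs_add_le _ _).trans (le_of_eq ?_)
  rw [abs_mul, abs_mul, abs_of_nonneg (a := 1 / _) (by positivity),
    abs_of_nonneg (a := 1 / _) (by positivity)]

/-- Multiplying `w_j` by `h_j^(1-p)` gives `l h_j^(-p/2) + m`, the Lagrange condition for least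
variance. Hence the variance sum is `l` times the bias sum plus `m` times the total weight. -/
lemma sum_decayWeight_sq_mul :
    ∑ j ∈ Finset.range n, decayWeight n₀ p l m j ^ 2 * ((j : ℝ) + 1 + n₀) ^ (1 - p) =
      l * (l * phi n₀ n 1 + m * phi n₀ n (1 - p / 2)) +
        m * (l * phi n₀ n (1 - p / 2) + m * phi n₀ n (1 - p)) := by
  rw [← sum_decayWeight_div, ← sum_decayWeight, Finset.mul_sum, Finset.mul_sum,
    ← Finset.sum_add_distrib]
  refine Finset.sum_congr rfl fun j _ => ?_
  have hx : (0 : ℝ) < (j : ℝ) + 1 + n₀ := by positivity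
  have h2 : ((j : ℝ) + 1 + n₀) ^ (1 - p / 2) =
      ((j : ℝ) + 1 + n₀) ^ (1 - p) * ((j : ℝ) + 1 + n₀) ^ (p / 2) := by
    rw [← Real.rpow_add hx]; congr 1; ring
  have h3 := Real.rpow_pos_of_pos hx (1 - p)
  have h4 := Real.rpow_pos_of_pos hx (p / 2)
  have h5 : decayWeight n₀ p l m j * ((j : ℝ) + 1 + n₀) ^ (1 - p) =
      l / ((j : ℝ) + 1 + n₀) ^ (p / 2) + m := by
    rw [decayWeight, h2]; field_simp
  rw [pow_two, mul_assoc, h5]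
  ring

end DecayWeight

/-- The first coefficient of the two-decay weights. -/
noncomputable def leadCoeff (n₀ : ℕ) (p : ℝ) (n : ℕ) (a : ℝ) : ℝ :=
  varianceCurvature n₀ p n * (a - varianceCenter n₀ p n)

/-- The second coefficient of the two-decay weights. -/
noncomputable def tailCoeff (n₀ : ℕ) (p : ℝ) (n : ℕ) (a : ℝ) : ℝ :=
  (1 - leadCoeff n₀ p n a * phi n₀ n (1 - p / 2)) / phi n₀ n (1 - p)

section Coeffs

variable {q₁ q₂ : ℝ} {n₀ n : ℕ}

lemma twoDecayWeights_eq (hq₁ : 0 < q₁) (hq₂ : 0 < q₂) (h : PhiNondegenerate q₁ q₂ n₀ n)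
    (a : ℝ) (j : Fin n) : twoDecayWeights q₁ q₂ n₀ n a j =
      decayWeight n₀ (q₁ / (q₁ + q₂)) (leadCoeff n₀ (q₁ / (q₁ + q₂)) n a)
        (tailCoeff n₀ (q₁ / (q₁ + q₂)) n a) j := by
  obtain ⟨x1, x2, x3, x4⟩ := xi_apply hq₁ hq₂ h
  obtain ⟨e1, e2, -⟩ := exponents_eq hq₁ hq₂
  have h1 := h.1
  have hl : coeffs q₁ q₂ n₀ n a 0 = leadCoeff n₀ (q₁ / (q₁ + q₂)) n a := by
    simp only [coeffs, Matrix.mulVec, dotProduct, Fin.sum_univ_two, x1, x2, leadCoeff,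
      Matrix.cons_val_zero, Matrix.cons_val_one]
    ring
  have hm : coeffs q₁ q₂ n₀ n a 1 = tailCoeff n₀ (q₁ / (q₁ + q₂)) n a := by
    simp only [coeffs, Matrix.mulVec, dotProduct, Fin.sum_univ_two, x3, x4, tailCoeff, leadCoeff,
      Matrix.cons_val_zero, Matrix.cons_val_one, varianceCenter]
    generalize varianceCurvature n₀ (q₁ / (q₁ + q₂)) n = r
    generalize phi n₀ n (1 - q₁ / (q₁ + q₂)) = F at *
    field_simp
    ring
  rw [twoDecayWeights, hl, hm, e1, e2, decayWeight]

/-- The coefficients solve the linear system of `phiMatrix` with right-hand side `(a, 1)`: the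
weights have total 1 and bias sum `a`. -/
lemma coeffs_constraints (h : PhiNondegenerate q₁ q₂ n₀ n) (a : ℝ) :
    leadCoeff n₀ (q₁ / (q₁ + q₂)) n a * phi n₀ n (1 - q₁ / (q₁ + q₂) / 2) +
        tailCoeff n₀ (q₁ / (q₁ + q₂)) n a * phi n₀ n (1 - q₁ / (q₁ + q₂)) = 1 ∧
      leadCoeff n₀ (q₁ / (q₁ + q₂)) n a * phi n₀ n 1 +
        tailCoeff n₀ (q₁ / (q₁ + q₂)) n a * phi n₀ n (1 - q₁ / (q₁ + q₂) / 2) = a := by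
  obtain ⟨h1, h2⟩ := h
  have h3 : varianceCurvature n₀ (q₁ / (q₁ + q₂)) n * (phi n₀ n 1 -
      phi n₀ n (1 - q₁ / (q₁ + q₂) / 2) ^ 2 / phi n₀ n (1 - q₁ / (q₁ + q₂))) = 1 := by
    rw [varianceCurvature, one_div, inv_mul_cancel₀ h2.ne']
  simp only [tailCoeff, leadCoeff, varianceCenter]
  generalize varianceCurvature n₀ (q₁ / (q₁ + q₂)) n = r at *
  generalize phi n₀ n (1 - q₁ / (q₁ + q₂)) = F at *
  generalize phi n₀ n (1 - q₁ / (q₁ + q₂) / 2) = G at *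
  generalize phi n₀ n 1 = H at *
  refine ⟨by field_simp; ring, ?_⟩
  have h4 : r * (a - G / F) * H + (1 - r * (a - G / F) * G) / F * G =
      (a - G / F) * (r * (H - G ^ 2 / F)) + G / F := by
    field_simp
    ring
  rw [h4, h3]
  ring

/-- Given the two constraints, the left-hand side is the variance sum by `sum_decayWeight_sq_mul`.
-/
lemma coeffs_variance (h : PhiNondegenerate q₁ q₂ n₀ n) (a : ℝ) :
    leadCoeff n₀ (q₁ / (q₁ + q₂)) n a * a + tailCoeff n₀ (q₁ / (q₁ + q₂)) n a =
      1 / phi n₀ n (1 - q₁ / (q₁ + q₂)) + varianceCurvature n₀ (q₁ / (q₁ + q₂)) n *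
        (a - varianceCenter n₀ (q₁ / (q₁ + q₂)) n) ^ 2 := by
  have h1 := h.1
  simp only [tailCoeff, leadCoeff, varianceCenter]
  generalize varianceCurvature n₀ (q₁ / (q₁ + q₂)) n = r
  generalize phi n₀ n (1 - q₁ / (q₁ + q₂)) = F at *
  field_simp
  ring

end Coeffs

/-! ### Asymptotics of optimal solutions and their coefficients -/

section OptimalAsymptotics

variable {n₀ : ℕ} {κ p : ℝ} {a : ℕ → ℝ}

lemma tendsto_scaled_sq (hκ : 0 < κ) (hp : 0 < p) (hp1 : p < 1)
    (ha : ∀ᶠ n in atTop, IsConstrainedMin κ p (1 / phi n₀ n (1 - p)) (varianceCurvature n₀ p n)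
      (varianceCenter n₀ p n) (a n)) :
    Tendsto (fun n => (a n * ((n : ℝ) + n₀) ^ (p / 2)) ^ 2) atTop (𝓝 (p / κ)) := by
  have hρ := eventually_varianceCurvature_pos n₀ hp hp1
  refine tendsto_sq_of_isConstrainedMin hκ hp hp1 hp (tendsto_inv_phi_mul n₀ hp hp1)
    (hρ.mono fun n h => h.le) (tendsto_varianceCurvature n₀ hp hp1)
    (tendsto_varianceCenter_mul n₀ hp hp1) ?_
  filter_upwards [ha, hρ, eventually_phi_pos n₀ (1 - p),
    (tendsto_rpow_half_atTop n₀ hp).eventually_gt_atTop 0] with n h1 h2 h3 h4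
  exact h1.scale (by positivity) h2.le h4

lemma eventually_abs_scaled_le (hκ : 0 < κ) (hp : 0 < p) (hp1 : p < 1)
    (ha : ∀ᶠ n in atTop, IsConstrainedMin κ p (1 / phi n₀ n (1 - p)) (varianceCurvature n₀ p n)
      (varianceCenter n₀ p n) (a n)) :
    ∀ᶠ n : ℕ in atTop, |a n * ((n : ℝ) + n₀) ^ (p / 2)| ≤ p / κ + 2 := by
  filter_upwards [(tendsto_scaled_sq hκ hp hp1 ha).eventually_lt_const (lt_add_one _)] with n hn
  rw [← sq_abs] at hn
  nlinarith [sq_nonneg (|a n * ((n : ℝ) + n₀) ^ (p / 2)| - 1)]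

lemma eventually_abs_scaled_sub_le (hκ : 0 < κ) (hp : 0 < p) (hp1 : p < 1)
    (ha : ∀ᶠ n in atTop, IsConstrainedMin κ p (1 / phi n₀ n (1 - p)) (varianceCurvature n₀ p n)
      (varianceCenter n₀ p n) (a n)) :
    ∀ᶠ n : ℕ in atTop,
      |(a n - varianceCenter n₀ p n) * ((n : ℝ) + n₀) ^ (p / 2)| ≤ p / κ + 5 := by
  -- The scaled centre tends to 2, hence is eventually below 3, and `5 = 2 + 3`.
  filter_upwards [eventually_abs_scaled_le hκ hp hp1 ha,
    (tendsto_varianceCenter_mul n₀ hp hp1).abs.eventually_lt_const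
      (by norm_num : |(2 : ℝ)| < 3)] with n h1 h2
  rw [sub_mul]
  exact (abs_sub _ _).trans (by linarith)

lemma isBoundedUnder_scaled_sub (hκ : 0 < κ) (hp : 0 < p) (hp1 : p < 1)
    (ha : ∀ᶠ n in atTop, IsConstrainedMin κ p (1 / phi n₀ n (1 - p)) (varianceCurvature n₀ p n)
      (varianceCenter n₀ p n) (a n)) :
    IsBoundedUnder (· ≤ ·) atTop ((‖·‖) ∘ fun n : ℕ =>
      (a n - varianceCenter n₀ p n) * ((n : ℝ) + n₀) ^ (p / 2)) :=
  isBoundedUnder_of_eventually_le (eventually_abs_scaled_sub_le hκ hp hp1 ha)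

lemma tendsto_scaled_variance (hκ : 0 < κ) (hp : 0 < p) (hp1 : p < 1)
    (ha : ∀ᶠ n in atTop, IsConstrainedMin κ p (1 / phi n₀ n (1 - p)) (varianceCurvature n₀ p n)
      (varianceCenter n₀ p n) (a n)) :
    Tendsto (fun n : ℕ => (1 / phi n₀ n (1 - p) + varianceCurvature n₀ p n *
      (a n - varianceCenter n₀ p n) ^ 2) * (((n : ℝ) + n₀) ^ (p / 2)) ^ 2) atTop (𝓝 p) := by
  have hb := isBoundedUnder_scaled_sub hκ hp hp1 ha
  have h1 : Tendsto (fun n => varianceCurvature n₀ p n *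
      ((a n - varianceCenter n₀ p n) * ((n : ℝ) + n₀) ^ (p / 2)) ^ 2) atTop (𝓝 0) := by
    refine (tendsto_varianceCurvature n₀ hp hp1).zero_mul_isBoundedUnder_le
      (isBoundedUnder_of_eventually_le (a := (p / κ + 5) ^ 2) ?_)
    filter_upwards [eventually_abs_scaled_sub_le hκ hp hp1 ha] with n hn
    rw [Function.comp_apply, Real.norm_eq_abs, abs_pow]
    exact pow_le_pow_left₀ (abs_nonneg _) hn 2
  have h2 := (tendsto_inv_phi_mul n₀ hp hp1).add h1
  rw [add_zero] at h2
  refine h2.congr fun n => ?_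
  ring

lemma tendsto_scaled_leadCoeff (hκ : 0 < κ) (hp : 0 < p) (hp1 : p < 1)
    (ha : ∀ᶠ n in atTop, IsConstrainedMin κ p (1 / phi n₀ n (1 - p)) (varianceCurvature n₀ p n)
      (varianceCenter n₀ p n) (a n)) :
    Tendsto (fun n : ℕ => leadCoeff n₀ p n (a n) * ((n : ℝ) + n₀) ^ (p / 2)) atTop (𝓝 0) := by
  refine ((tendsto_varianceCurvature n₀ hp hp1).zero_mul_isBoundedUnder_le
    (isBoundedUnder_scaled_sub hκ hp hp1 ha)).congr fun n => ?_
  rw [leadCoeff, mul_assoc]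

lemma tendsto_tailCoeff_mul_sq (hκ : 0 < κ) (hp : 0 < p) (hp1 : p < 1)
    (ha : ∀ᶠ n in atTop, IsConstrainedMin κ p (1 / phi n₀ n (1 - p)) (varianceCurvature n₀ p n)
      (varianceCenter n₀ p n) (a n)) :
    Tendsto (fun n : ℕ => tailCoeff n₀ p n (a n) * (((n : ℝ) + n₀) ^ (p / 2)) ^ 2) atTop
      (𝓝 p) := by
  have h1 := (((tendsto_scaled_leadCoeff hκ hp hp1 ha).mul
    (tendsto_phi_half_div n₀ hp hp1)).const_sub 1).mul (tendsto_inv_phi_mul n₀ hp hp1)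
  rw [zero_mul, sub_zero, one_mul] at h1
  refine h1.congr' ?_
  filter_upwards [(tendsto_rpow_half_atTop n₀ hp).eventually_gt_atTop 0] with n hn
  unfold tailCoeff
  field_simp

lemma tendsto_scaled_tailCoeff (hκ : 0 < κ) (hp : 0 < p) (hp1 : p < 1)
    (ha : ∀ᶠ n in atTop, IsConstrainedMin κ p (1 / phi n₀ n (1 - p)) (varianceCurvature n₀ p n)
      (varianceCenter n₀ p n) (a n)) :
    Tendsto (fun n : ℕ => tailCoeff n₀ p n (a n) * ((n : ℝ) + n₀) ^ (p / 2)) atTop (𝓝 0) := by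
  refine ((tendsto_tailCoeff_mul_sq hκ hp hp1 ha).div_atTop
    (tendsto_rpow_half_atTop n₀ hp)).congr' ?_
  filter_upwards [(tendsto_rpow_half_atTop n₀ hp).eventually_gt_atTop 0] with n hn
  field_simp

/-- The absolute row-sum bound for the Toeplitz lemma. The factor 2 bounds curvature times `φ(1)`,
which tends to 1; the last bracket is the limit of the tail part plus one. -/
lemma eventually_scaled_coeffs_le (hκ : 0 < κ) (hp : 0 < p) (hp1 : p < 1)
    (ha : ∀ᶠ n in atTop, IsConstrainedMin κ p (1 / phi n₀ n (1 - p)) (varianceCurvature n₀ p n)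
      (varianceCenter n₀ p n) (a n)) :
    ∀ᶠ n : ℕ in atTop, |leadCoeff n₀ p n (a n) * ((n : ℝ) + n₀) ^ (p / 2)| * phi n₀ n 1 +
      |tailCoeff n₀ p n (a n) * ((n : ℝ) + n₀) ^ (p / 2)| * phi n₀ n (1 - p / 2) ≤
        2 * (p / κ + 5) + (p * (2 / p) + 1) := by
  have htail := (tendsto_tailCoeff_mul_sq hκ hp hp1 ha).abs.mul (tendsto_phi_half_div n₀ hp hp1)
  rw [abs_of_pos hp] at htail
  filter_upwards [eventually_abs_scaled_sub_le hκ hp hp1 ha,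
    (tendsto_varianceCurvature_mul_phi_one n₀ hp hp1).eventually_lt_const one_lt_two,
    eventually_varianceCurvature_pos n₀ hp hp1, eventually_phi_pos n₀ 1,
    htail.eventually_lt_const (lt_add_one _),
    (tendsto_rpow_half_atTop n₀ hp).eventually_gt_atTop 0] with n h1 h2 h3 h4 h5 h6
  refine add_le_add ?_ (le_trans (le_of_eq ?_) h5.le)
  · rw [leadCoeff, mul_assoc, abs_mul, abs_of_pos h3]
    calc _ = varianceCurvature n₀ p n * phi n₀ n 1 *
          |(a n - varianceCenter n₀ p n) * ((n : ℝ) + n₀) ^ (p / 2)| := by ring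
      _ ≤ 2 * (p / κ + 5) := mul_le_mul h2.le h1 (abs_nonneg _) (by norm_num)
  · rw [abs_mul, abs_mul, abs_of_pos h6, abs_of_pos (pow_pos h6 2)]
    field_simp

end OptimalAsymptotics

/-! ### Limit risk of the two-decay weights -/

section WeightedLimit

variable {q₁ q₂ K : ℝ} {n₀ : ℕ}

/-- The scaled mean square error of the two-decay weights converges, for every simulation
output. -/
lemma exists_mseWeighted_eq (hq₁ : 0 < q₁) (hq₂ : 0 < q₂) (hK : 0 < K)
    {W : (n : ℕ) → Fin n → ℝ}
    (hW : ∀ᶠ n : ℕ in atTop, ∃ a : ℝ, IsOptimalSolution q₁ q₂ K n₀ n a ∧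
      W n = twoDecayWeights q₁ q₂ n₀ n a) (S : SimulationOutput.{u} q₁ q₂) {d : ℝ} (hd : 0 < d) :
    ∃ x : ℕ → ℝ, (∀ᶠ n in atTop, mseWeighted n₀ S (K * d) (W n) = ENNReal.ofReal (x n)) ∧
      Tendsto (fun n : ℕ => (((n : ℝ) + n₀) ^ (q₁ / (q₁ + q₂) / 2)) ^ 2 * x n) atTop
        (𝓝 (q₁ / (q₁ + q₂) * (1 / K ^ (2 * q₂)) * S.limitMSE d)) := by
  obtain ⟨hp, hp1⟩ := div_add_mem_Ioo hq₁ hq₂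
  set p := q₁ / (q₁ + q₂)
  set κ := K ^ (2 * (q₁ + q₂)) with hκ_def
  have hκ : 0 < κ := Real.rpow_pos_of_pos hK _
  have hKd : 0 < K * d := mul_pos hK hd
  obtain ⟨a, ha⟩ := hW.choice
  have hnd := eventually_phiNondegenerate n₀ hq₁ hq₂
  have hmin : ∀ᶠ n in atTop, IsConstrainedMin κ p (1 / phi n₀ n (1 - p))
      (varianceCurvature n₀ p n) (varianceCenter n₀ p n) (a n) := by
    filter_upwards [ha, hnd] with n h1 h2
    exact (isOptimalSolution_iff hq₁ hq₂ K h2 _).1 h1.1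
  let h : ℕ → ℝ := fun j => (j : ℝ) + 1 + n₀
  have hh : ∀ j, 0 < h j := fun j => by positivity
  have hhtop : Tendsto h atTop atTop := by
    simp only [h, add_assoc]
    exact tendsto_natCast_add_atTop _
  let δ : ℕ → ℝ := fun j => K * d * h j ^ (-rateExponent q₁ q₂)
  have hδ : Tendsto δ atTop (𝓝[>] 0) := tendsto_tuning hq₁ hq₂ hKd hhtop
  let b : ℕ → ℝ := fun j => S.b (δ j) / δ j ^ q₁
  have hb : Tendsto b atTop (𝓝 S.B) := S.tendsto_bias_div.comp hδ
  let v : ℕ → ℝ := fun j => Var[S.ε (δ j); S.P]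
  have hv : Tendsto v atTop (𝓝 S.σsq) := S.noise_var.comp hδ
  let M : ℕ → ℝ := fun n => ((n : ℝ) + n₀) ^ (p / 2)
  let l : ℕ → ℝ := fun n => leadCoeff n₀ p n (a n)
  let m : ℕ → ℝ := fun n => tailCoeff n₀ p n (a n)
  let w : ℕ → ℕ → ℝ := fun n j => decayWeight n₀ p (l n) (m n) j
  have hMw : ∀ n j, M n * w n j = decayWeight n₀ p (l n * M n) (m n * M n) j := by
    intro n j
    simp only [w, decayWeight]
    ring
  have hMw0 : ∀ j, Tendsto (fun n => M n * w n j) atTop (𝓝 0) := by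
    intro j
    have := ((tendsto_scaled_leadCoeff hκ hp hp1 hmin).div_const (h j ^ (1 - p / 2))).add
      ((tendsto_scaled_tailCoeff hκ hp hp1 hmin).div_const (h j ^ (1 - p)))
    simp only [zero_div, add_zero] at this
    exact this.congr fun n => (hMw n j).symm
  -- Replacing the bias coefficients by their limit `S.B` costs nothing after scaling; the variances
  -- are treated likewise in `hvar0`.
  have hbias0 : Tendsto (fun n => ∑ j ∈ Finset.range n, (M n * w n j / h j ^ (p / 2)) *
      (b j - S.B)) atTop (𝓝 0) := by
    refine tendsto_sum_mul_zero_of_toeplitz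
      (C := 2 * (p / κ + 5) + (p * (2 / p) + 1)) (fun j => ?_) ?_ ?_
    · simpa using (hMw0 j).div_const (h j ^ (p / 2))
    · filter_upwards [eventually_scaled_coeffs_le hκ hp hp1 hmin] with n hn
      refine le_trans ?_ hn
      simp only [hMw]
      exact sum_abs_decayWeight_div_le _ _ _ _ _
    · simpa using hb.sub_const S.B
  have hbias : ∀ᶠ n in atTop, M n * ∑ j ∈ Finset.range n, w n j / h j ^ (p / 2) * b j =
      S.B * (a n * M n) + ∑ j ∈ Finset.range n, (M n * w n j / h j ^ (p / 2)) *
        (b j - S.B) := by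
    filter_upwards [hnd] with n hn
    have h1 : a n = ∑ j ∈ Finset.range n, w n j / h j ^ (p / 2) := by
      simp only [w, h]
      rw [sum_decayWeight_div]
      exact (coeffs_constraints hn (a n)).2.symm
    rw [h1, Finset.sum_mul, Finset.mul_sum, Finset.mul_sum, ← Finset.sum_add_distrib]
    exact Finset.sum_congr rfl fun j _ => by ring
  have hbiassq : Tendsto (fun n => (M n * ∑ j ∈ Finset.range n, w n j / h j ^ (p / 2) * b j) ^ 2)
      atTop (𝓝 (S.B ^ 2 * (p / κ))) := by
    -- Since only the square of `a n * M n` is known to converge, the cross term is handled as null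
    -- times bounded.
    have h1 := hbias0.zero_mul_isBoundedUnder_le (g := fun n => a n * M n)
      (isBoundedUnder_of_eventually_le (eventually_abs_scaled_le hκ hp hp1 hmin))
    have h2 := (((tendsto_scaled_sq hκ hp hp1 hmin).const_mul (S.B ^ 2)).add
      (h1.const_mul (2 * S.B))).add (hbias0.pow 2)
    simp only [mul_zero, add_zero, ne_eq, OfNat.ofNat_ne_zero, not_false_eq_true, zero_pow] at h2
    refine h2.congr' ?_
    filter_upwards [hbias] with n hn
    rw [hn]
    ring
  have hcsum : Tendsto (fun n => ∑ j ∈ Finset.range n, (M n * w n j) ^ 2 * h j ^ (1 - p)) atTop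
      (𝓝 p) := by
    refine (tendsto_scaled_variance hκ hp hp1 hmin).congr' ?_
    filter_upwards [hnd] with n hn
    have h1 := sum_decayWeight_sq_mul n₀ p (l n) (m n) n
    have h2 := coeffs_constraints hn (a n)
    have h3 := coeffs_variance hn (a n)
    have h4 : ∑ j ∈ Finset.range n, w n j ^ 2 * h j ^ (1 - p) =
        1 / phi n₀ n (1 - p) + varianceCurvature n₀ p n * (a n - varianceCenter n₀ p n) ^ 2 := by
      rw [← h3]
      refine h1.trans ?_
      change _ * (leadCoeff n₀ p n (a n) * _ + tailCoeff n₀ p n (a n) * _) +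
        _ * (leadCoeff n₀ p n (a n) * _ + tailCoeff n₀ p n (a n) * _) = _
      rw [h2.1, h2.2, mul_one]
    rw [← h4, Finset.sum_mul]
    exact Finset.sum_congr rfl fun j _ => by simp only [M]; ring
  have hvar0 : Tendsto (fun n => ∑ j ∈ Finset.range n, ((M n * w n j) ^ 2 * h j ^ (1 - p)) *
      (v j - S.σsq)) atTop (𝓝 0) := by
    refine tendsto_sum_mul_zero_of_toeplitz (C := p + 1) (fun j => ?_) ?_ ?_
    · simpa using ((hMw0 j).pow 2).mul_const (h j ^ (1 - p))
    · filter_upwards [hcsum.eventually_lt_const (lt_add_one p)] with n hn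
      refine le_trans (le_of_eq (Finset.sum_congr rfl fun j _ => abs_of_nonneg ?_)) hn.le
      have := hh j
      positivity
    · simpa using hv.sub_const S.σsq
  have hvar : Tendsto (fun n => ∑ j ∈ Finset.range n, ((M n * w n j) ^ 2 * h j ^ (1 - p)) * v j)
      atTop (𝓝 (p * S.σsq)) := by
    have := (hcsum.mul_const S.σsq).add hvar0
    rw [add_zero] at this
    refine this.congr fun n => ?_
    rw [Finset.sum_mul, ← Finset.sum_add_distrib]
    exact Finset.sum_congr rfl fun j _ => by ring
  refine ⟨fun n => ((K * d) ^ q₁ * ∑ j ∈ Finset.range n, w n j / h j ^ (p / 2) * b j) ^ 2 +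
    1 / ((K * d) ^ q₂) ^ 2 * ∑ j ∈ Finset.range n, w n j ^ 2 * h j ^ (1 - p) * v j, ?_, ?_⟩
  · filter_upwards [ha, hnd] with n h1 h2
    have h3 : ∀ j : Fin n, W n j = w n j := fun j => by
      rw [h1.2, twoDecayWeights_eq hq₁ hq₂ h2]
    rw [mseWeighted_eq hq₁ hq₂ n₀ S hKd (W n) (b := b) (v := v) (fun _ => rfl) (fun _ => rfl)]
    simp only [h3]
    rw [Fin.sum_univ_eq_sum_range (fun j => w n j), Fin.sum_univ_eq_sum_range
      (fun j => w n j / ((j : ℝ) + 1 + n₀) ^ (q₁ / (q₁ + q₂) / 2) * b j),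
      Fin.sum_univ_eq_sum_range
      (fun j => w n j ^ 2 * ((j : ℝ) + 1 + n₀) ^ (1 - q₁ / (q₁ + q₂)) * v j)]
    -- The total is exactly 1, so the unknown `θ` drops out.
    have h4 : ∑ j ∈ Finset.range n, w n j = 1 :=
      (sum_decayWeight n₀ p (l n) (m n) n).trans (coeffs_constraints h2 (a n)).1
    rw [h4, sub_self, mul_zero, zero_add]
  · have hlim := (hbiassq.const_mul (((K * d) ^ q₁) ^ 2)).add
      (hvar.const_mul (1 / ((K * d) ^ q₂) ^ 2))
    -- The balance: `K^(2q₁)/κ = K^(-2q₂)`, so bias and variance shrink by the same factor.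
    have hval : ((K * d) ^ q₁) ^ 2 * (S.B ^ 2 * (p / κ)) +
        1 / ((K * d) ^ q₂) ^ 2 * (p * S.σsq) = p * (1 / K ^ (2 * q₂)) * S.limitMSE d := by
      have hsq : ∀ q : ℝ, K ^ (2 * q) = (K ^ q) ^ 2 := fun q => by
        rw [mul_comm, Real.rpow_mul hK.le, Real.rpow_two]
      have hK1 : 0 < K ^ q₁ := Real.rpow_pos_of_pos hK _
      have hK2 : 0 < K ^ q₂ := Real.rpow_pos_of_pos hK _
      have hd2 : 0 < d ^ q₂ := Real.rpow_pos_of_pos hd _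
      rw [hκ_def, hsq, hsq, Real.rpow_add hK, Real.mul_rpow hK.le hd.le,
        Real.mul_rpow hK.le hd.le, SimulationOutput.limitMSE]
      field_simp
    rw [hval] at hlim
    refine hlim.congr fun n => ?_
    have h1 : ∑ j ∈ Finset.range n, ((M n * w n j) ^ 2 * h j ^ (1 - p)) * v j =
        M n ^ 2 * ∑ j ∈ Finset.range n, w n j ^ 2 * h j ^ (1 - p) * v j := by
      rw [Finset.mul_sum]
      exact Finset.sum_congr rfl fun j _ => by ring
    rw [h1]
    change _ = M n ^ 2 * _
    ring

/-- With two-decay weights the risk ratio is the same for every simulation output. -/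
lemma riskRatio_twoDecay (hq₁ : 0 < q₁) (hq₂ : 0 < q₂) (hK : 0 < K) {W : (n : ℕ) → Fin n → ℝ}
    (hW : ∀ᶠ n : ℕ in atTop, ∃ a : ℝ, IsOptimalSolution q₁ q₂ K n₀ n a ∧
      W n = twoDecayWeights q₁ q₂ n₀ n a) (S : SimulationOutput.{u} q₁ q₂) {d : ℝ} (hd : 0 < d) :
    riskRatio n₀ S d (K * d) W = ENNReal.ofReal (q₁ / (q₁ + q₂) * (1 / K ^ (2 * q₂))) := by
  obtain ⟨x, hx, hxlim⟩ := exists_mseWeighted_eq hq₁ hq₂ hK hW S hd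
  obtain ⟨y, hy, hylim⟩ := exists_mseBaseline_eq hq₁ hq₂ n₀ S hd
  have hL := S.limitMSE_pos hd
  refine Tendsto.limsup_eq ?_
  have h1 := hxlim.div hylim hL.ne'
  rw [mul_div_cancel_right₀ _ hL.ne'] at h1
  refine (ENNReal.tendsto_ofReal h1).congr' ?_
  filter_upwards [hx, hy, hylim.eventually_const_lt hL,
    (tendsto_rpow_half_atTop n₀ (div_add_mem_Ioo hq₁ hq₂).1).eventually_gt_atTop 0]
    with n h2 h3 h4 h5
  have h6 : 0 < y n := pos_of_mul_pos_right h4 (by positivity)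
  rw [h2, h3, ← ENNReal.ofReal_div_of_pos h6, Pi.div_apply, mul_div_mul_left _ _ (pow_pos h5 2).ne']

end WeightedLimit

/-! ### Outputs with coin-flip noise, in an arbitrary universe -/

/-- The sample space of a fair coin. -/
inductive Coin : Type u
  | heads : Coin
  | tails : Coin

namespace Coin

instance : MeasurableSpace Coin.{u} := ⊤

instance : DiscreteMeasurableSpace Coin.{u} := ⟨fun _ => trivial⟩

/-- The law of a fair coin. -/
noncomputable def law : Measure Coin.{u} :=
  (2⁻¹ : ℝ≥0∞) • Measure.dirac Coin.heads + (2⁻¹ : ℝ≥0∞) • Measure.dirac Coin.tails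

instance : IsProbabilityMeasure law.{u} := ⟨by
  simp [law, ENNReal.inv_two_add_inv_two]⟩

/-- A random sign. -/
def sign : Coin.{u} → ℝ
  | heads => 1
  | tails => -1

lemma measurable_sign : Measurable sign.{u} := Measurable.of_discrete

lemma sign_sq (ω : Coin.{u}) : sign ω ^ 2 = 1 := by
  cases ω <;> norm_num [sign]

lemma memLp_sign : MemLp sign.{u} 2 law := by
  refine MemLp.of_bound measurable_sign.aestronglyMeasurable 1 (.of_forall fun ω => ?_)
  rw [Real.norm_eq_abs, ← sq_le_one_iff_abs_le_one, sign_sq]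

lemma integral_sign : ∫ ω, sign.{u} ω ∂law = 0 := by
  have hi : ∀ x, Integrable sign.{u} ((2⁻¹ : ℝ≥0∞) • Measure.dirac x) := fun x =>
    (integrable_dirac (by simp)).smul_measure (by simp)
  rw [law, integral_add_measure (hi _) (hi _), integral_smul_measure, integral_smul_measure,
    integral_dirac, integral_dirac]
  simp [sign]

lemma variance_sign : Var[sign.{u}; law] = 1 := by
  rw [variance_eq_sub memLp_sign, integral_sign]
  have : sign.{u} ^ 2 = fun _ => 1 := funext sign_sq
  rw [this]
  simp

end Coin

/-- The simulation output `θ + δ ^ q₁ ± σ / δ ^ q₂` with a random sign. -/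
noncomputable def SimulationOutput.coin (q₁ q₂ θ : ℝ) {σ : ℝ} (hσ : 0 < σ) :
    SimulationOutput.{u} q₁ q₂ where
  Ω := Coin.{u}
  P := Coin.law
  θ := θ
  b δ := δ ^ q₁
  ε _ ω := σ * Coin.sign ω
  B := 1
  σsq := σ ^ 2
  B_ne := one_ne_zero
  σsq_pos := by positivity
  bias := by simp
  noise_memLp _ _ := Coin.memLp_sign.const_mul σ
  noise_mean _ _ := by rw [integral_const_mul, Coin.integral_sign, mul_zero]
  noise_var := by
    simp only [variance_const_mul, Coin.variance_sign, mul_one]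
    exact tendsto_const_nhds

/-! ### The lower bound -/

section LowerBound

variable {q₁ q₂ K : ℝ} {n₀ : ℕ}

/-- Cauchy-Schwarz: bounds the variance sum from below by the squared total weight. -/
lemma sq_sum_le_phi_mul (p : ℝ) {n : ℕ} (w : Fin n → ℝ) :
    (∑ j, w j) ^ 2 ≤
      phi n₀ n (1 - p) * ∑ j : Fin n, w j ^ 2 * (((j : ℕ) : ℝ) + 1 + n₀) ^ (1 - p) := by
  refine Finset.sum_sq_le_sum_mul_sum_of_sq_le_mul _ (fun j _ => by positivity)
    (fun j _ => by positivity) fun j _ => le_of_eq ?_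
  have : (0 : ℝ) < (((j : ℕ) : ℝ) + 1 + n₀) ^ (1 - p) := by positivity
  field_simp

/-- A bound on the risk ratio of the coin outputs at `d = 1`, written out. -/
lemma exists_bound_of_riskRatio_lt (hq₁ : 0 < q₁) (hq₂ : 0 < q₂) {c σ r : ℝ} (hc : 0 < c)
    (hσ : 0 < σ) (θ : ℝ) {W : (n : ℕ) → Fin n → ℝ}
    (h : riskRatio n₀ (SimulationOutput.coin.{u} q₁ q₂ θ hσ) 1 c W < ENNReal.ofReal r) :
    ∃ y : ℕ → ℝ,
      Tendsto (fun n : ℕ => (((n : ℝ) + n₀) ^ (q₁ / (q₁ + q₂) / 2)) ^ 2 * y n) atTop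
        (𝓝 (1 + σ ^ 2)) ∧
      ∀ᶠ n in atTop, (θ * (∑ j, W n j - 1) + c ^ q₁ *
          ∑ j : Fin n, W n j / (((j : ℕ) : ℝ) + 1 + n₀) ^ (q₁ / (q₁ + q₂) / 2)) ^ 2 +
        σ ^ 2 / (c ^ q₂) ^ 2 *
          ∑ j : Fin n, W n j ^ 2 * (((j : ℕ) : ℝ) + 1 + n₀) ^ (1 - q₁ / (q₁ + q₂)) ≤ r * y n := by
  set S := SimulationOutput.coin.{u} q₁ q₂ θ hσ with hS
  obtain ⟨y, hy, hylim⟩ := exists_mseBaseline_eq hq₁ hq₂ n₀ S one_pos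
  have hL : S.limitMSE 1 = 1 + σ ^ 2 := by
    simp [SimulationOutput.limitMSE, hS, SimulationOutput.coin]
  rw [hL] at hylim
  refine ⟨y, hylim, ?_⟩
  filter_upwards [eventually_lt_of_limsup_lt h, hy,
    hylim.eventually_const_lt (by positivity : 0 < 1 + σ ^ 2)] with n h1 h2 h3
  have hy0 : 0 < y n := pos_of_mul_pos_right h3 (by positivity)
  -- For coin outputs the bias coefficients and noise variances are exactly constant.
  rw [mseWeighted_eq hq₁ hq₂ n₀ S hc (W n) (b := fun _ => 1) (v := fun _ => σ ^ 2)
    (fun j => ?_) (fun j => ?_), h2, ← ENNReal.ofReal_div_of_pos hy0] at h1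
  · simp only [mul_one, ← Finset.sum_mul] at h1
    have h4 := (ENNReal.ofReal_lt_ofReal_iff'.1 h1).1
    rw [div_lt_iff₀ hy0] at h4
    refine le_trans (le_of_eq ?_) h4.le
    simp only [hS, SimulationOutput.coin]
    ring
  · exact (div_self (Real.rpow_pos_of_pos (mul_pos hc (by positivity)) _).ne').symm
  · change σ ^ 2 = Var[fun ω => σ * Coin.sign ω; Coin.law]
    rw [variance_const_mul, Coin.variance_sign, mul_one]

/-- No calibration has a smaller worst-case risk ratio. -/
lemma le_worstRiskRatio (hq₁ : 0 < q₁) (hq₂ : 0 < q₂) (hK : 0 < K) {g : ℝ → ℝ}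
    (hg : g ∈ calibrations K) (W : (n : ℕ) → Fin n → ℝ) :
    ENNReal.ofReal (q₁ / (q₁ + q₂) * (1 / K ^ (2 * q₂))) ≤
      worstRiskRatio.{u} q₁ q₂ n₀ g W := by
  obtain ⟨hp, hp1⟩ := div_add_mem_Ioo hq₁ hq₂
  set p := q₁ / (q₁ + q₂)
  by_contra! hlt
  obtain ⟨r, hr0, hr1, hr2⟩ := ENNReal.lt_iff_exists_real_btwn.1 hlt
  have hr2' : r < p * (1 / K ^ (2 * q₂)) := (ENNReal.ofReal_lt_ofReal_iff'.1 hr2).1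
  set r₀ := p * (1 / K ^ (2 * q₂))
  obtain ⟨hc, hcK⟩ := hg 1 one_pos
  rw [mul_one] at hcK
  set c := g 1
  -- Since `r < r₀`, large noise suffices: any `σ² > r/(r₀ - r)` works.
  obtain ⟨σ, hσ, hσr⟩ : ∃ σ : ℝ, 0 < σ ∧ r * (1 + σ ^ 2) < r₀ * σ ^ 2 := by
    have h1 : 0 < r₀ - r := sub_pos.2 hr2'
    have h2 : 0 < r / (r₀ - r) + 1 := by positivity
    refine ⟨√(r / (r₀ - r) + 1), Real.sqrt_pos.2 h2, ?_⟩
    rw [Real.sq_sqrt h2.le]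
    have h3 : (r₀ - r) * (r / (r₀ - r) + 1) = r + (r₀ - r) := by field_simp
    nlinarith
  have hsup : ∀ S : SimulationOutput.{u} q₁ q₂,
      riskRatio n₀ S 1 c W ≤ worstRiskRatio.{u} q₁ q₂ n₀ g W := fun S => by
    refine le_iSup₂_of_le S 1 ?_
    rw [iSup_pos one_pos]
  have hbound := fun θ : ℝ => exists_bound_of_riskRatio_lt (n₀ := n₀) (W := W) hq₁ hq₂ hc hσ θ
    (lt_of_le_of_lt (hsup _) hr1)
  -- For `θ = 0` the vanishing error forces the bias sum to 0; comparing with `θ = 1` then forces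
  -- the total weight to 1.
  obtain ⟨y, hy, hyW⟩ := hbound 0
  obtain ⟨z, hz, hzW⟩ := hbound 1
  let M : ℕ → ℝ := fun n => ((n : ℝ) + n₀) ^ (p / 2)
  have hM : Tendsto M atTop atTop := tendsto_rpow_half_atTop n₀ hp
  let A : ℕ → ℝ := fun n => c ^ q₁ *
    ∑ j : Fin n, W n j / (((j : ℕ) : ℝ) + 1 + n₀) ^ (p / 2)
  let V : ℕ → ℝ := fun n => ∑ j : Fin n, W n j ^ 2 * (((j : ℕ) : ℝ) + 1 + n₀) ^ (1 - p)
  have hV0 : ∀ n, 0 ≤ V n := fun n => Finset.sum_nonneg fun j _ => by positivity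
  have hvan : ∀ x : ℕ → ℝ, Tendsto (fun n => M n ^ 2 * x n) atTop (𝓝 (1 + σ ^ 2)) →
      Tendsto (fun n => r * x n) atTop (𝓝 0) := by
    intro x hx
    have h1 := (hx.div_atTop ((tendsto_pow_atTop two_ne_zero).comp hM)).const_mul r
    rw [mul_zero] at h1
    refine h1.congr' ?_
    filter_upwards [hM.eventually_gt_atTop 0] with n hn
    simp only [Function.comp_apply]
    field_simp
  have hsq : ∀ x t : ℕ → ℝ, Tendsto (fun n => r * x n) atTop (𝓝 0) →
      (∀ᶠ n in atTop, t n ^ 2 + σ ^ 2 / (c ^ q₂) ^ 2 * V n ≤ r * x n) →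
      Tendsto t atTop (𝓝 0) := by
    intro x t hx ht
    have h1 : Tendsto (fun n => t n ^ 2) atTop (𝓝 0) := by
      refine tendsto_of_tendsto_of_tendsto_of_le_of_le' tendsto_const_nhds hx
        (.of_forall fun n => sq_nonneg _) ?_
      filter_upwards [ht] with n hn
      have : 0 ≤ σ ^ 2 / (c ^ q₂) ^ 2 * V n := mul_nonneg (by positivity) (hV0 n)
      linarith
    have h2 := h1.sqrt
    simp only [Real.sqrt_sq_eq_abs, Real.sqrt_zero] at h2
    exact (tendsto_zero_iff_abs_tendsto_zero _).2 h2
  have hA : Tendsto A atTop (𝓝 0) := by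
    refine hsq y A (hvan y hy) ?_
    filter_upwards [hyW] with n hn
    rwa [zero_mul, zero_add] at hn
  have hsA : Tendsto (fun n => 1 * (∑ j, W n j - 1) + A n) atTop (𝓝 0) :=
    hsq z _ (hvan z hz) hzW
  have hs : Tendsto (fun n => ∑ j, W n j) atTop (𝓝 1) := by
    have := (hsA.sub hA).add_const 1
    simp only [sub_zero, zero_add] at this
    exact this.congr fun n => by ring
  have hlow : Tendsto (fun n => σ ^ 2 / (K ^ q₂) ^ 2 * ((∑ j, W n j) ^ 2 *
      (1 / phi n₀ n (1 - p) * M n ^ 2))) atTop (𝓝 (σ ^ 2 / (K ^ q₂) ^ 2 * (1 ^ 2 * p))) :=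
    ((hs.pow 2).mul (tendsto_inv_phi_mul n₀ hp hp1)).const_mul _
  -- Keeping only the variance and letting `n → ∞` gives `r₀ σ² ≤ r (1 + σ²)`, against the choice of
  -- `σ`.
  have hle := le_of_tendsto_of_tendsto hlow (hy.const_mul r) ?_
  · have h1 : σ ^ 2 / (K ^ q₂) ^ 2 * (1 ^ 2 * p) = r₀ * σ ^ 2 := by
      simp only [r₀]
      rw [mul_comm 2 q₂, Real.rpow_mul hK.le, Real.rpow_two]
      ring
    rw [h1] at hle
    exact hσr.not_ge hle
  · filter_upwards [hyW, eventually_phi_pos n₀ (1 - p)] with n h1 h2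
    have h3 : (∑ j, W n j) ^ 2 * (1 / phi n₀ n (1 - p)) ≤ V n := by
      rw [mul_one_div, div_le_iff₀ h2, mul_comm]
      exact sq_sum_le_phi_mul p (W n)
    have hcq : 0 < c ^ q₂ := Real.rpow_pos_of_pos hc _
    -- The only use of `g 1 ≤ K`: tuning inflated by at most `K` cannot reduce the noise further.
    have h4 : σ ^ 2 / (K ^ q₂) ^ 2 ≤ σ ^ 2 / (c ^ q₂) ^ 2 := by gcongr
    have h5 : σ ^ 2 / (c ^ q₂) ^ 2 * V n ≤ r * y n :=
      (le_add_of_nonneg_left (sq_nonneg _)).trans h1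
    calc _ = σ ^ 2 / (K ^ q₂) ^ 2 * ((∑ j, W n j) ^ 2 * (1 / phi n₀ n (1 - p))) * M n ^ 2 := by
          ring
      _ ≤ σ ^ 2 / (c ^ q₂) ^ 2 * V n * M n ^ 2 := by gcongr
      _ ≤ r * y n * M n ^ 2 := by gcongr
      _ = r * (M n ^ 2 * y n) := by ring

end LowerBound

/-! ### The minimax theorem -/

theorem theorem5 (q₁ q₂ K : ℝ) (hq₁ : 0 < q₁) (hq₂ : 0 < q₂) (hK : 0 < K) (n₀ : ℕ) :
    -- the asymptotic minimax risk ratio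
    IsLeast {r : ℝ≥0∞ | ∃ g ∈ calibrations K, ∃ W : (n : ℕ) → Fin n → ℝ,
        r = worstRiskRatio.{u} q₁ q₂ n₀ g W}
      (ENNReal.ofReal (q₁ / (q₁ + q₂) * (1 / K ^ (2 * q₂)))) ∧
    -- for all large `n` the matrix is invertible and the problem in `a` has an optimal solution
    (∀ᶠ n : ℕ in atTop, IsUnit (phiMatrix q₁ q₂ n₀ n).det ∧
      ∃ a : ℝ, IsOptimalSolution q₁ q₂ K n₀ n a) ∧
    -- two-decay weights built from optimal solutions, with `g d = K d`, attain the minimax ratio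
    (∀ W : (n : ℕ) → Fin n → ℝ,
      (∀ᶠ n : ℕ in atTop, ∃ a : ℝ, IsOptimalSolution q₁ q₂ K n₀ n a ∧
        W n = twoDecayWeights q₁ q₂ n₀ n a) →
      worstRiskRatio.{u} q₁ q₂ n₀ (fun d => K * d) W =
          ENNReal.ofReal (q₁ / (q₁ + q₂) * (1 / K ^ (2 * q₂))) ∧
        ∃ S : SimulationOutput.{u} q₁ q₂, ∃ d : ℝ, 0 < d ∧
          riskRatio n₀ S d (K * d) W =
            ENNReal.ofReal (q₁ / (q₁ + q₂) * (1 / K ^ (2 * q₂)))) := by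
  have hg : (fun d => K * d) ∈ calibrations K := fun d hd => ⟨mul_pos hK hd, le_rfl⟩
  have hsolv := eventually_exists_isOptimalSolution hq₁ hq₂ hK n₀
  have hworst : ∀ W : (n : ℕ) → Fin n → ℝ,
      (∀ᶠ n : ℕ in atTop, ∃ a : ℝ, IsOptimalSolution q₁ q₂ K n₀ n a ∧
        W n = twoDecayWeights q₁ q₂ n₀ n a) →
      worstRiskRatio.{u} q₁ q₂ n₀ (fun d => K * d) W =
        ENNReal.ofReal (q₁ / (q₁ + q₂) * (1 / K ^ (2 * q₂))) := by
    intro W hW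
    refine le_antisymm ?_ (le_worstRiskRatio hq₁ hq₂ hK hg W)
    exact iSup₂_le fun S d => iSup_le fun hd => (riskRatio_twoDecay hq₁ hq₂ hK hW S hd).le
  refine ⟨⟨?_, ?_⟩, hsolv, fun W hW => ⟨hworst W hW, ?_⟩⟩
  · obtain ⟨a, ha⟩ := (hsolv.mono fun n h => h.2).choice
    exact ⟨_, hg, fun n => twoDecayWeights q₁ q₂ n₀ n (a n),
      (hworst _ (ha.mono fun n h => ⟨a n, h, rfl⟩)).symm⟩
  · rintro _ ⟨g, hg', W, rfl⟩
    exact le_worstRiskRatio hq₁ hq₂ hK hg' W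
  -- The ratio is the same for every output, so any member of the class attains the supremum.
  · exact ⟨SimulationOutput.coin.{u} q₁ q₂ 0 one_pos, 1, one_pos,
      riskRatio_twoDecay hq₁ hq₂ hK hW _ one_pos⟩
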